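/- Let $\mathbb{C}_+=\{z\in\mathbb{C}:\operatorname{Re}z>0\}$. Let $\mathcal{B}$ be the space of all holomorphic functions $f$ on $\mathbb{C}_+$ such that $$\|f\|_{\mathcal{B}_0}:=\int_0^\infty\sup_{\beta\in\mathbb{R}}|f'(\alpha+i\beta)|\,d\alpha<\infty,$$ with the norm $\|f\|_{\mathcal{B}}:=\sup_{z\in\mathbb{C}_+}|f(z)|+\|f\|_{\mathcal{B}_0}$, and let $\mathcal{B}_0:=\{f\in\mathcal{B}: \lim_{\operatorname{Re}z\to\infty}f(z)=0\}$. Let $H^\infty(\mathbb{C}_+)$ be the algebra of bounded holomorphic functions on $\mathbb{C}_+$, and for $f\in H^\infty(\mathbb{C}_+)$ let $f^b\in L^\infty(\mathbb{R})$, $f^b(s)=\lim_{\alpha\to0+}f(\alpha+is)$ for a.e. $s$, be its boundary function. For $I\subset(0,\infty)$ compact let $$H^\infty_I:=\{f\in H^\infty(\mathbb{C}_+): \operatorname{supp}(\mathcal{F}^{-1}f^b)\subset I\},$$ where $\mathcal{F}$ is the Fourier transform of tempered distributions, normalized by $(\mathcal{F}\varphi)(s)=\int_{\mathbb{R}}\varphi(t)e^{-ist}\,dt$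 for Schwartz functions $\varphi$. Let $$\mathcal{G}:=\bigcup\{H^\infty_I: I\subset(0,\infty)\text{ compact}\}.$$ **Theorem.** $\mathcal{G}$ is a subalgebra (not containing the constant function $1$) of the algebra of functions on $\mathbb{C}_+$, it is contained in $\mathcal{B}_0$, every function in $\mathcal{G}$ is the restriction to $\mathbb{C}_+$ of an entire function of exponential type, and the closure of $\mathcal{G}$ in $\mathcal{B}$ with respect to $\|\cdot\|_{\mathcal{B}}$ is $\mathcal{B}_0$. In particular, $\mathcal{G}$ is dense in $\mathcal{B}_0$. -/

import Mathlib

open MeasureTheory Set Filter Topology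
open scoped ENNReal SchwartzMap FourierTransform

noncomputable section

namespace AnalyticBesov

/-- The open right half-plane. -/
def Cplus : Set ℂ := {z | 0 < z.re}

/-- The extension by zero to `ℂ` of a function on the right half-plane. As the half-plane is open,
the behaviour of the extension at its points does not depend on the values outside. -/
def ext (f : Cplus → ℂ) : ℂ → ℂ := Function.extend Subtype.val f 0

/-- Holomorphic functions on the right half-plane. -/
def Hol : Set (Cplus → ℂ) := {f | DifferentiableOn ℂ (ext f) Cplus}

/-- The supremum norm, with value `∞` for unbounded functions. -/
def supNorm (f : Cplus → ℂ) : ℝ≥0∞ := ⨆ z : Cplus, ‖f z‖ₑ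

/-- `∫₀^∞ sup_β |f'(α + iβ)| dα`, for holomorphic `f`. -/
def besovSeminorm (f : Cplus → ℂ) : ℝ≥0∞ :=
  ∫⁻ α in Ioi (0 : ℝ), ⨆ β : ℝ, ‖deriv (ext f) (α + Complex.I * β)‖ₑ

/-- The norm of the space of analytic Besov functions. -/
def besovNorm (f : Cplus → ℂ) : ℝ≥0∞ := supNorm f + besovSeminorm f

/-- The space `𝓑` of analytic Besov functions on the right half-plane. -/
def Besov : Set (Cplus → ℂ) := {f | f ∈ Hol ∧ besovSeminorm f < ∞}

/-- The space `𝓑₀` of those `f ∈ 𝓑` with `f(∞) = 0`, where `f(∞)` is the limit of `f(z)`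
as `Re z → ∞`. -/
def Besov₀ : Set (Cplus → ℂ) :=
  {f | f ∈ Besov ∧ Tendsto f (comap (fun z : Cplus => (z : ℂ).re) atTop) (𝓝 0)}

/-- The closure in `𝓑`, for the norm of `𝓑`, of a set of functions. -/
def besovClosure (S : Set (Cplus → ℂ)) : Set (Cplus → ℂ) :=
  {f | f ∈ Besov ∧ ∀ ε : ℝ≥0∞, 0 < ε → ∃ g ∈ S, besovNorm (f - g) < ε}

/-- Bounded holomorphic functions on the right half-plane. -/
def Hinfty : Set (Cplus → ℂ) := {f | f ∈ Hol ∧ ∃ C : ℝ, ∀ z, ‖f z‖ ≤ C}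

/-- `g ∈ L^∞(ℝ)` is the boundary function of `f`: `g(s) = lim_{α → 0+} f(α + is)` for almost
every `s`. -/
def IsBoundaryFunction (f : Cplus → ℂ) (g : Lp ℂ ∞ (volume : Measure ℝ)) : Prop :=
  ∀ᵐ s : ℝ, Tendsto (fun α : ℝ => ext f (α + Complex.I * s)) (𝓝[>] 0) (𝓝 (g s))

/-- The support of the distributional inverse Fourier transform of `g`, for the angular frequency
normalization `(𝓕 φ)(s) = ∫ φ(t) e^{-ist} dt`. Mathlib's Fourier transform has the kernel
`e^{-2πist}`, so that its frequencies `ξ` correspond to the angular frequencies `2πξ`. -/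
def invFourierSupport (g : Lp ℂ ∞ (volume : Measure ℝ)) : Set ℝ :=
  (fun ξ : ℝ => 2 * Real.pi * ξ) ''
    Distribution.dsupport (𝓕⁻ (Lp.toTemperedDistribution g) : 𝓢'(ℝ, ℂ))

/-- The spectral subspace `H^∞_I`: bounded holomorphic functions on the right half-plane, the
inverse Fourier transform of whose boundary function has its support in `I`. -/
def spectralSubspace (I : Set ℝ) : Set (Cplus → ℂ) :=
  {f | f ∈ Hinfty ∧
    ∃ g : Lp ℂ ∞ (volume : Measure ℝ), IsBoundaryFunction f g ∧ invFourierSupport g ⊆ I}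

/-- The union `𝓖` of the spectral subspaces over all compact subsets of `(0, ∞)`. -/
def G : Set (Cplus → ℂ) :=
  {f | ∃ I : Set ℝ, IsCompact I ∧ I ⊆ Ioi 0 ∧ f ∈ spectralSubspace I}

/-- `f` is the restriction of an entire function of exponential type. -/
def IsEntireOfExponentialType (f : Cplus → ℂ) : Prop :=
  ∃ F : ℂ → ℂ, Differentiable ℂ F ∧ (∃ C c : ℝ, ∀ z, ‖F z‖ ≤ C * Real.exp (c * ‖z‖)) ∧
    ∀ z : Cplus, F z = f z

end AnalyticBesov

end

/-!
The proof rests on a Paley–Wiener description of `𝓖` (`mem_G_iff`): a function belongs to `𝓖` if and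
only if it is the restriction of an entire function `F` with `‖F z‖ ≤ C (e^{-a Re z} + e^{-b Re z})`
for some `0 < a ≤ b`. These bounds are stable under sums and products, they bound the exponential
type, and by Cauchy's estimates they make `F'` decay exponentially as `Re z → ∞`, uniformly up to the
imaginary axis, which gives the algebra structure, the extension, and the inclusion in `𝓑₀`.

The tool is the convolution of a bounded holomorphic function `f`, along vertical lines, with the
Laplace transform of a test function `κ` (`halfPlaneConv`). This Laplace transform is entire and
decays quadratically in vertical strips, so by Cauchy's theorem the line of integration can be moved
within the half-plane. Moving it to the boundary (`halfPlaneConv_eq_conv`) shows that the result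
depends only on the boundary function, on which the convolution acts as multiplication by `κ` of the
inverse Fourier transform; moving it to `+∞` (`halfPlaneConv_eq_zero`) shows that negative
frequencies do not contribute. Rescaled cut-off functions `χ(t / r)` with `χ = 1` near `0` form an
approximate identity as `r → ∞`.

If `f` has its spectrum in a compact set `I ⊆ (0, ∞)`, all large cut-offs have the same effect on `f`
as a fixed test function that equals one near `I`; hence `f` is a convolution of its boundary
function with the Laplace transform of that test function, and satisfies the Paley–Wiener bounds.
Conversely, if `F` satisfies the bounds for `[a, b]`, its boundary function is annihilated by the
Fourier transforms of test functions supported on one side of `[a, b]`, as the contour in the pairing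
can be moved to `+∞` or to `-∞` (`integral_mul_laplace_eq_zero`).

For the density, the convolution of `f ∈ 𝓑₀` with the Laplace transform of `χ(t / n) - χ(n t)` is in
`𝓖` after dropping the negative frequencies. The difference of the derivatives is bounded on the line
`Re z = α` by a multiple of `sup_β |f'(α + iβ)|`, which is integrable in `α`, and also by
`(A / α² + D) / n`, so dominated convergence applies. The supremum norm is controlled by the seminorm
on `𝓑₀` (`supNorm_le_besovSeminorm`).
-/

open scoped ContDiff Manifold

namespace AnalyticBesov


/-! ### Laplace transforms of test functions -/

/-- The bilateral Laplace transform `z ↦ ∫ κ(t) e^{-zt} dt`. -/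
noncomputable def laplace (κ : ℝ → ℂ) (z : ℂ) : ℂ := ∫ t : ℝ, κ t * Complex.exp (-(z * t))

/-- The growth in `x = Re z` of Laplace transforms of functions supported in `[a, b]`: for `a ≤ b`
it is of the order of `e^{-ax}` for positive `x` and of `e^{-bx}` for negative `x`. -/
noncomputable def expGrowth (a b x : ℝ) : ℝ := Real.exp (-(a * x)) + Real.exp (-(b * x))

/-- Smooth functions on the line supported in `[a, b]`. -/
structure IsKernel (κ : ℝ → ℂ) (a b : ℝ) : Prop where
  smooth : ContDiff ℝ ∞ κ
  supp : tsupport κ ⊆ Icc a b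

lemma expGrowth_nonneg (a b x : ℝ) : 0 ≤ expGrowth a b x := by
  unfold expGrowth; positivity

lemma continuous_expGrowth (a b : ℝ) : Continuous (expGrowth a b) := by
  unfold expGrowth; fun_prop

lemma exp_le_expGrowth {a b t : ℝ} (ht : t ∈ Icc a b) (x : ℝ) :
    Real.exp (-(t * x)) ≤ expGrowth a b x := by
  unfold expGrowth
  rcases le_total 0 x with hx | hx
  · have : Real.exp (-(t * x)) ≤ Real.exp (-(a * x)) := by
      gcongr; exact ht.1
    linarith [Real.exp_pos (-(b * x))]
  · have : Real.exp (-(t * x)) ≤ Real.exp (-(b * x)) := by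
      apply Real.exp_le_exp.2
      nlinarith [ht.2]
    linarith [Real.exp_pos (-(a * x))]

namespace IsKernel

variable {κ η : ℝ → ℂ} {a b : ℝ}

lemma continuous (h : IsKernel κ a b) : Continuous κ := h.smooth.continuous

lemma hasCompactSupport (h : IsKernel κ a b) : HasCompactSupport κ :=
  isCompact_Icc.of_isClosed_subset (isClosed_tsupport κ) h.supp

lemma eq_zero (h : IsKernel κ a b) {t : ℝ} (ht : t ∉ Icc a b) : κ t = 0 :=
  image_eq_zero_of_notMem_tsupport fun h' => ht (h.supp h')

lemma integrable (h : IsKernel κ a b) : Integrable κ :=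
  h.continuous.integrable_of_hasCompactSupport h.hasCompactSupport

lemma integrable_mul (h : IsKernel κ a b) {g : ℝ → ℂ} (hg : Continuous g) :
    Integrable fun t => κ t * g t :=
  (h.continuous.mul hg).integrable_of_hasCompactSupport h.hasCompactSupport.mul_right

lemma mul_left (h : IsKernel κ a b) {g : ℝ → ℂ} (hg : ContDiff ℝ ∞ g) :
    IsKernel (fun t => g t * κ t) a b :=
  ⟨hg.mul h.smooth, (tsupport_mul_subset_right (f := g) (g := κ)).trans h.supp⟩

lemma sub (h : IsKernel κ a b) {c d : ℝ} (h' : IsKernel η c d) :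
    IsKernel (fun t => κ t - η t) (min a c) (max b d) :=
  ⟨h.smooth.sub h'.smooth, (tsupport_sub κ η).trans (union_subset
    (h.supp.trans (Icc_subset_Icc (min_le_left _ _) (le_max_left _ _)))
    (h'.supp.trans (Icc_subset_Icc (min_le_right _ _) (le_max_right _ _))))⟩

lemma deriv (h : IsKernel κ a b) : IsKernel (deriv κ) a b :=
  ⟨(contDiff_infty_iff_deriv.1 h.smooth).2, (tsupport_deriv_subset).trans h.supp⟩

/-- Multiplication by `-t`, which the Laplace transform turns into differentiation. -/
lemma neg_mul_self (h : IsKernel κ a b) : IsKernel (fun t : ℝ => -(t : ℂ) * κ t) a b :=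
  h.mul_left (Complex.ofRealCLM.contDiff.neg)

lemma of_forall_notMem (hs : ContDiff ℝ ∞ κ) (h0 : ∀ t, t ∉ Icc a b → κ t = 0) :
    IsKernel κ a b :=
  ⟨hs, closure_minimal (fun t ht => by by_contra h; exact ht (h0 t h)) isClosed_Icc⟩

lemma comp_div (h : IsKernel κ a b) {r : ℝ} (hr : 0 < r) :
    IsKernel (fun t => κ (t / r)) (a * r) (b * r) := by
  refine of_forall_notMem (h.smooth.comp (contDiff_id.div_const r)) fun t ht => h.eq_zero ?_
  contrapose! ht
  rwa [mem_Icc, le_div_iff₀ hr, div_le_iff₀ hr] at ht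

lemma norm_laplace_le (h : IsKernel κ a b) (z : ℂ) :
    ‖laplace κ z‖ ≤ (∫ t, ‖κ t‖) * expGrowth a b z.re := by
  rw [← integral_mul_const]
  refine norm_integral_le_of_norm_le (h.integrable.norm.mul_const _) (ae_of_all _ fun t => ?_)
  by_cases ht : t ∈ Icc a b
  · rw [norm_mul, Complex.norm_exp]
    gcongr
    refine le_of_eq_of_le ?_ (exp_le_expGrowth ht _)
    simp [mul_comm]
  · simp [h.eq_zero ht]

lemma laplace_deriv (h : IsKernel κ a b) (z : ℂ) :
    laplace (_root_.deriv κ) z = z * laplace κ z := by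
  have hv (t : ℝ) : HasDerivAt (fun t : ℝ => Complex.exp (-(z * t)))
      (-z * Complex.exp (-(z * t))) t := by
    have := ((Complex.ofRealCLM.hasDerivAt (x := t)).const_mul z).neg.cexp
    simpa [mul_comm] using this
  have := integral_mul_deriv_eq_deriv_mul_of_integrable (u := κ)
    (fun t _ => (h.smooth.differentiable (by simp) t).hasDerivAt) (fun t _ => hv t)
    (h.integrable_mul (by fun_prop)) (h.deriv.integrable_mul (by fun_prop))
    (h.integrable_mul (by fun_prop))
  rw [laplace, laplace, ← integral_const_mul, ← neg_inj, ← this, ← integral_neg]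
  congr 1; ext t; ring

/-- Laplace transforms of test functions decay quadratically in vertical strips. -/
lemma exists_norm_laplace_le (h : IsKernel κ a b) :
    ∃ C : ℝ, 0 ≤ C ∧ ∀ z, ‖laplace κ z‖ ≤ C * expGrowth a b z.re * (1 + z.im ^ 2)⁻¹ := by
  refine ⟨(∫ t, ‖κ t‖) + ∫ t, ‖_root_.deriv (_root_.deriv κ) t‖, by positivity, fun z => ?_⟩
  have h1 := h.norm_laplace_le z
  have h2 := h.deriv.deriv.norm_laplace_le z
  rw [h.deriv.laplace_deriv, h.laplace_deriv, norm_mul, norm_mul] at h2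
  have h3 : z.im ^ 2 ≤ ‖z‖ * ‖z‖ := by
    rw [← Complex.sq_norm_sub_sq_re]; nlinarith [sq_nonneg z.re]
  rw [← div_eq_mul_inv, le_div_iff₀ (by positivity)]
  nlinarith [norm_nonneg (laplace κ z), mul_le_mul_of_nonneg_left h3 (norm_nonneg (laplace κ z))]

lemma hasDerivAt_laplace (h : IsKernel κ a b) (z : ℂ) :
    HasDerivAt (laplace κ) (laplace (fun t : ℝ => -(t : ℂ) * κ t) z) z := by
  refine (hasDerivAt_integral_of_dominated_loc_of_deriv_le (Metric.ball_mem_nhds z one_pos)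
    (bound := fun t : ℝ => ‖-(t : ℂ) * κ t‖ * Real.exp ((‖z‖ + 1) * |t|))
    (Eventually.of_forall fun w => (h.integrable_mul (by fun_prop)).aestronglyMeasurable)
    (h.integrable_mul (by fun_prop))
    (F' := fun w (t : ℝ) => -(t : ℂ) * κ t * Complex.exp (-(w * t)))
    (h.neg_mul_self.integrable_mul (by fun_prop)).aestronglyMeasurable
    (ae_of_all _ fun t w hw => ?_) ?_ (ae_of_all _ fun t w _ => ?_)).2
  · rw [norm_mul, Complex.norm_exp]
    gcongr
    refine (Complex.re_le_norm _).trans ?_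
    rw [norm_neg, norm_mul, Complex.norm_real, Real.norm_eq_abs]
    gcongr
    have := norm_sub_norm_le w z
    rw [mem_ball_iff_norm] at hw
    linarith
  · exact (h.neg_mul_self.continuous.norm.mul (by fun_prop)).integrable_of_hasCompactSupport
      h.neg_mul_self.hasCompactSupport.norm.mul_right
  · have := ((hasDerivAt_id w).mul_const (t : ℂ)).neg.cexp.const_mul (κ t)
    refine this.congr_deriv ?_
    simp only [Pi.neg_apply, id]; ring

lemma differentiable_laplace (h : IsKernel κ a b) : Differentiable ℂ (laplace κ) :=
  fun z => (h.hasDerivAt_laplace z).differentiableAt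

lemma continuous_laplace (h : IsKernel κ a b) : Continuous (laplace κ) :=
  h.differentiable_laplace.continuous

lemma integrable_laplace (h : IsKernel κ a b) :
    Integrable fun v : ℝ => laplace κ (Complex.I * v) := by
  obtain ⟨C, -, hC⟩ := h.exists_norm_laplace_le
  refine (integrable_inv_one_add_sq.const_mul (C * expGrowth a b 0)).mono'
    (h.continuous_laplace.comp (by fun_prop)).aestronglyMeasurable (ae_of_all _ fun v => ?_)
  simpa using hC (Complex.I * v)

lemma integrable_mul_laplace (h : IsKernel κ a b) :
    Integrable fun v : ℝ => (v : ℂ) * laplace κ (Complex.I * v) := by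
  have := h.deriv.integrable_laplace.const_mul (-Complex.I)
  refine this.congr (ae_of_all _ fun v => ?_)
  simp only [h.laplace_deriv]
  linear_combination (-v * laplace κ (Complex.I * v)) * Complex.I_mul_I

/-- Fourier inversion at the origin. -/
lemma integral_laplace (h : IsKernel κ a b) :
    ∫ v : ℝ, laplace κ (Complex.I * v) = 2 * Real.pi * κ 0 := by
  have hF : 𝓕 κ = fun ξ : ℝ => laplace κ (Complex.I * (2 * Real.pi * ξ : ℝ)) := by
    ext ξ
    rw [Real.fourier_eq', laplace]
    congr 1; ext t
    rw [smul_eq_mul, mul_comm]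
    congr 2
    simp; ring
  have hp : (0 : ℝ) < 2 * Real.pi := by positivity
  have hint : Integrable (𝓕 κ) := by
    rw [hF]
    exact h.integrable_laplace.comp_mul_left' hp.ne'
  have h1 := congrFun (h.continuous.fourierInv_fourier_eq h.integrable hint) 0
  rw [Real.fourierInv_eq', hF] at h1
  simp only [inner_zero_right, mul_zero, Complex.ofReal_zero, zero_mul, Complex.exp_zero,
    one_smul] at h1
  rw [Measure.integral_comp_mul_left (fun v : ℝ => laplace κ (Complex.I * v))] at h1
  rw [← h1, abs_of_pos (inv_pos.2 hp), Complex.real_smul]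
  push_cast
  field_simp

end IsKernel

lemma laplace_comp_div (κ : ℝ → ℂ) {r : ℝ} (hr : 0 < r) (z : ℂ) :
    laplace (fun t => κ (t / r)) z = r * laplace κ (r * z) := by
  have := Measure.integral_comp_div (fun t : ℝ => κ t * Complex.exp (-(r * z * t))) r
  rw [abs_of_pos hr, Complex.real_smul] at this
  rw [laplace, laplace, ← this]
  congr 1; ext t
  have : (r : ℂ) ≠ 0 := by exact_mod_cast hr.ne'
  push_cast
  congr 3
  field_simp


/-! ### Convolution of functions on a vertical line with Laplace transforms -/

/-- The convolution of `φ`, regarded as a function on the imaginary axis, with the Laplace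
transform of `κ`. The factor `1 / 2π` makes this the multiplication of the inverse Fourier
transform of `φ` by `κ`. -/
noncomputable def conv (φ : ℝ → ℂ) (κ : ℝ → ℂ) (z : ℂ) : ℂ :=
  (2 * Real.pi : ℂ)⁻¹ * ∫ v : ℝ, φ v * laplace κ (z - Complex.I * v)

lemma integrable_inv_one_add_sub_sq (y : ℝ) :
    Integrable fun v : ℝ => (1 + (y - v) ^ 2)⁻¹ :=
  integrable_inv_one_add_sq.comp_sub_left y

lemma exists_expGrowth_le (a b c d : ℝ) : ∃ G, 0 ≤ G ∧ ∀ x ∈ Icc c d, expGrowth a b x ≤ G := by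
  obtain ⟨G, hG⟩ := isCompact_Icc.exists_bound_of_continuousOn
    (continuous_expGrowth a b).continuousOn (s := Icc c d)
  refine ⟨|G|, abs_nonneg _, fun x hx => ?_⟩
  exact (le_abs_self _).trans ((hG x hx).trans (le_abs_self G))

namespace IsKernel

variable {κ : ℝ → ℂ} {a b : ℝ}

/-- Uniform version of `IsKernel.exists_norm_laplace_le` in a vertical strip. -/
lemma exists_norm_laplace_sub_le (h : IsKernel κ a b) (c d : ℝ) :
    ∃ C : ℝ, 0 ≤ C ∧ ∀ z : ℂ, z.re ∈ Icc c d → ‖laplace κ z‖ ≤ C * (1 + z.im ^ 2)⁻¹ := by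
  obtain ⟨C, hC, hb⟩ := h.exists_norm_laplace_le
  obtain ⟨G, hG, hG'⟩ := exists_expGrowth_le a b c d
  refine ⟨C * G, by positivity, fun z hz => (hb z).trans ?_⟩
  gcongr
  exact hG' _ hz

lemma integrable_mul_laplace_sub (h : IsKernel κ a b) {φ : ℝ → ℂ}
    (hφ : AEStronglyMeasurable φ) {M : ℝ} (hM : ∀ᵐ v, ‖φ v‖ ≤ M) (z : ℂ) :
    Integrable fun v : ℝ => φ v * laplace κ (z - Complex.I * v) := by
  obtain ⟨C, hC, hb⟩ := h.exists_norm_laplace_sub_le z.re z.re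
  refine ((integrable_inv_one_add_sub_sq z.im).const_mul (M * C)).mono'
    (hφ.mul (h.continuous_laplace.comp (by fun_prop)).aestronglyMeasurable) ?_
  filter_upwards [hM] with v hv
  rw [norm_mul, mul_assoc]
  have := hb (z - Complex.I * v) (by simp)
  exact mul_le_mul hv (by simpa using this) (norm_nonneg _) ((norm_nonneg _).trans hv)

lemma exists_norm_conv_le (h : IsKernel κ a b) :
    ∃ C : ℝ, 0 ≤ C ∧ ∀ (φ : ℝ → ℂ) (M : ℝ), (∀ᵐ v, ‖φ v‖ ≤ M) →
      ∀ z, ‖conv φ κ z‖ ≤ C * M * expGrowth a b z.re := by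
  obtain ⟨C, hC, hb⟩ := h.exists_norm_laplace_le
  refine ⟨‖(2 * Real.pi : ℂ)⁻¹‖ * (C * ∫ v : ℝ, (1 + v ^ 2)⁻¹),
    mul_nonneg (norm_nonneg _) (mul_nonneg hC (integral_nonneg fun v => by positivity)),
    fun φ M hM z => ?_⟩
  rw [conv, norm_mul, mul_assoc, mul_assoc]
  gcongr
  have : ∫ v : ℝ, (1 + v ^ 2)⁻¹ = ∫ v : ℝ, (1 + (z.im - v) ^ 2)⁻¹ :=
    (integral_sub_left_eq_self (fun v : ℝ => (1 + v ^ 2)⁻¹) volume z.im).symm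
  rw [this, mul_comm C, mul_assoc, mul_comm, ← integral_const_mul]
  refine norm_integral_le_of_norm_le
    ((integrable_inv_one_add_sub_sq z.im).const_mul _) ?_
  filter_upwards [hM] with v hv
  have h1 := hb (z - Complex.I * v)
  simp only [Complex.sub_re, Complex.mul_re, Complex.I_re, Complex.ofReal_re, zero_mul,
    Complex.I_im, Complex.ofReal_im, mul_zero, sub_zero, Complex.sub_im, Complex.mul_im,
    one_mul, zero_add] at h1
  calc ‖φ v * laplace κ (z - Complex.I * v)‖
      ≤ M * (C * expGrowth a b z.re * (1 + (z.im - v) ^ 2)⁻¹) := by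
        rw [norm_mul]
        exact mul_le_mul hv h1 (norm_nonneg _) ((norm_nonneg _).trans hv)
    _ = _ := by ring

lemma hasDerivAt_conv (h : IsKernel κ a b) {φ : ℝ → ℂ}
    (hφ : AEStronglyMeasurable φ) {M : ℝ} (hM : ∀ᵐ v, ‖φ v‖ ≤ M) (z : ℂ) :
    HasDerivAt (conv φ κ) (conv φ (fun t : ℝ => -(t : ℂ) * κ t) z) z := by
  obtain ⟨C, hC, hb⟩ := h.neg_mul_self.exists_norm_laplace_sub_le (z.re - 1) (z.re + 1)
  refine HasDerivAt.const_mul _ (hasDerivAt_integral_of_dominated_loc_of_deriv_le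
    (Metric.ball_mem_nhds z one_pos)
    (bound := fun v => M * (C * (3 * (1 + (z.im - v) ^ 2)⁻¹)))
    (F := fun z (v : ℝ) => φ v * laplace κ (z - Complex.I * v))
    (Eventually.of_forall fun w => (h.integrable_mul_laplace_sub hφ hM w).aestronglyMeasurable)
    (h.integrable_mul_laplace_sub hφ hM z)
    (F' := fun w v => φ v * laplace (fun t : ℝ => -(t : ℂ) * κ t) (w - Complex.I * v))
    (h.neg_mul_self.integrable_mul_laplace_sub hφ hM z).aestronglyMeasurable
    ?_ (((integrable_inv_one_add_sub_sq z.im).const_mul 3).const_mul C |>.const_mul M)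
    (ae_of_all _ fun v w _ => ?_)).2
  · filter_upwards [hM] with v hv w hw
    rw [mem_ball_iff_norm] at hw
    have hre := abs_le.1 ((Complex.abs_re_le_norm (w - z)).trans hw.le)
    have him := abs_le.1 ((Complex.abs_im_le_norm (w - z)).trans hw.le)
    simp only [Complex.sub_re, Complex.sub_im] at hre him
    have h1 := hb (w - Complex.I * v) (by simp; constructor <;> linarith)
    rw [norm_mul]
    refine mul_le_mul hv (h1.trans ?_) (norm_nonneg _) ((norm_nonneg _).trans hv)
    gcongr
    simp only [Complex.sub_im, Complex.mul_im, Complex.I_re, Complex.ofReal_im, mul_zero,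
      Complex.I_im, Complex.ofReal_re, one_mul, zero_add]
    rw [← div_eq_mul_inv, inv_le_iff_one_le_mul₀ (by positivity), div_mul_eq_mul_div,
      one_le_div (by positivity)]
    nlinarith [sq_nonneg (w.im - v - (w.im - z.im)), sq_nonneg (w.im - v + (w.im - z.im))]
  · have := (h.hasDerivAt_laplace (w - Complex.I * v)).comp w
      ((hasDerivAt_id w).sub_const (Complex.I * v))
    simpa [Function.comp_def] using this.const_mul (φ v)

end IsKernel

/-! ### Shifting contours -/

/-- Cauchy's theorem for two vertical lines bounding a strip in which the function decays
quadratically. -/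
lemma integral_vertical_eq {P : ℂ → ℂ} {x₁ x₂ y M : ℝ} (hx : x₁ ≤ x₂)
    (hd : DifferentiableOn ℂ P {z | z.re ∈ Icc x₁ x₂})
    (hb : ∀ z : ℂ, z.re ∈ Icc x₁ x₂ → ‖P z‖ ≤ M * (1 + (y - z.im) ^ 2)⁻¹) :
    ∫ v : ℝ, P (x₁ + Complex.I * v) = ∫ v : ℝ, P (x₂ + Complex.I * v) := by
  have hint (x : ℝ) (h : x ∈ Icc x₁ x₂) : Integrable fun v : ℝ => P (x + Complex.I * v) := by
    refine ((integrable_inv_one_add_sub_sq y).const_mul M).mono' ?_ (ae_of_all _ fun v => ?_)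
    · exact (hd.continuousOn.comp_continuous (by fun_prop)
        (fun v => by simpa using h)).aestronglyMeasurable
    · simpa using hb (x + Complex.I * v) (by simpa using h)
  have hlim (x : ℝ) (h : x ∈ Icc x₁ x₂) :
      Tendsto (fun n : ℕ => ∫ v in (-n : ℝ)..n, P (x + v * Complex.I)) atTop
        (𝓝 (∫ v : ℝ, P (x + Complex.I * v))) := by
    simp_rw [mul_comm _ Complex.I]
    exact intervalIntegral_tendsto_integral (hint x h)
      (tendsto_neg_atTop_atBot.comp tendsto_natCast_atTop_atTop) tendsto_natCast_atTop_atTop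
  have hhor (s : ℝ) (hs : s = 1 ∨ s = -1) :
      Tendsto (fun n : ℕ => ∫ x in x₁..x₂, P (x + (s * n : ℝ) * Complex.I)) atTop (𝓝 0) := by
    have h0 : Tendsto (fun n : ℕ => M * (1 + (y - s * n) ^ 2)⁻¹ * |x₂ - x₁|) atTop (𝓝 0) := by
      have : Tendsto (fun n : ℕ => 1 + (y - s * n) ^ 2) atTop atTop := by
        refine tendsto_atTop_add_const_left _ _ ?_
        rcases hs with rfl | rfl
        · have : Tendsto (fun n : ℕ => -y + (n : ℝ)) atTop atTop :=
            tendsto_atTop_add_const_left _ _ tendsto_natCast_atTop_atTop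
          refine ((tendsto_pow_atTop two_ne_zero).comp this).congr fun n => ?_
          simp only [Function.comp]; ring
        · have : Tendsto (fun n : ℕ => y + (n : ℝ)) atTop atTop :=
            tendsto_atTop_add_const_left _ _ tendsto_natCast_atTop_atTop
          refine ((tendsto_pow_atTop two_ne_zero).comp this).congr fun n => ?_
          simp only [Function.comp]; ring
      simpa using (this.inv_tendsto_atTop.const_mul M).mul_const |x₂ - x₁|
    refine squeeze_zero_norm (fun n => ?_) h0
    refine intervalIntegral.norm_integral_le_of_norm_le_const fun x hx' => ?_
    rw [uIoc_of_le hx] at hx'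
    simpa using hb (x + (s * n : ℝ) * Complex.I) (by simpa using Ioc_subset_Icc_self hx')
  have hrect (n : ℕ) := Complex.integral_boundary_rect_eq_zero_of_differentiableOn P
    (x₁ + ((-1 : ℝ) * n : ℝ) * Complex.I) (x₂ + ((1 : ℝ) * n : ℝ) * Complex.I)
    (hd.mono fun z hz => by
      have := hz.1
      simpa [uIcc_of_le hx] using this)
  have h1 := (((hhor (-1) (Or.inr rfl)).sub (hhor 1 (Or.inl rfl))).add
    ((hlim x₂ ⟨hx, le_rfl⟩).const_smul Complex.I)).sub
    ((hlim x₁ ⟨le_rfl, hx⟩).const_smul Complex.I)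
  have h2 := tendsto_nhds_unique (h1.congr fun n => by simpa using hrect n) tendsto_const_nhds
  rw [sub_zero, zero_add, ← smul_sub, smul_eq_zero, sub_eq_zero] at h2
  exact (h2.resolve_left Complex.I_ne_zero).symm


/-! ### Convolution of bounded holomorphic functions on the half-plane -/

/-- The convolution of a holomorphic function `f` on the right half-plane with the Laplace transform
of `κ`, formed on the vertical line `Re w = 1`; by `halfPlaneConv_eq`, any line in the half-plane
gives the same function. -/
noncomputable def halfPlaneConv (f : ℂ → ℂ) (κ : ℝ → ℂ) (z : ℂ) : ℂ :=
  conv (fun v => f (1 + Complex.I * v)) κ (z - 1)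

lemma isOpen_Cplus : IsOpen Cplus := isOpen_lt continuous_const Complex.continuous_re

lemma ball_subset_Cplus (z : ℂ) : Metric.ball z z.re ⊆ Cplus := by
  intro w hw
  rw [mem_ball_iff_norm] at hw
  have := abs_lt.1 ((Complex.abs_re_le_norm (w - z)).trans_lt hw)
  simp only [Complex.sub_re] at this
  show 0 < w.re
  linarith

/-- A holomorphic function on the right half-plane that is bounded by `M`. -/
structure IsBoundedHol (f : ℂ → ℂ) (M : ℝ) : Prop where
  diff : DifferentiableOn ℂ f Cplus
  bound : ∀ z ∈ Cplus, ‖f z‖ ≤ M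

namespace IsBoundedHol

variable {f : ℂ → ℂ} {M : ℝ} {κ : ℝ → ℂ} {a b : ℝ}

lemma continuous_vertical (hf : IsBoundedHol f M) {x : ℝ} (hx : 0 < x) :
    Continuous fun v : ℝ => f (x + Complex.I * v) :=
  hf.diff.continuousOn.comp_continuous (by fun_prop) fun v => by simpa [Cplus] using hx

lemma norm_vertical_le (hf : IsBoundedHol f M) {x : ℝ} (hx : 0 < x) (v : ℝ) :
    ‖f (x + Complex.I * v)‖ ≤ M :=
  hf.bound _ (by simpa [Cplus] using hx)

lemma conv_vertical_eq (hf : IsBoundedHol f M) (h : IsKernel κ a b) {x₁ x₂ : ℝ} (h₁ : 0 < x₁)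
    (h₁₂ : x₁ ≤ x₂) (z : ℂ) :
    conv (fun v => f (x₁ + Complex.I * v)) κ (z - x₁) =
      conv (fun v => f (x₂ + Complex.I * v)) κ (z - x₂) := by
  obtain ⟨C, hC, hb⟩ := h.exists_norm_laplace_sub_le (z.re - x₂) (z.re - x₁)
  unfold conv
  congr 1
  simp_rw [sub_sub]
  refine integral_vertical_eq (P := fun w => f w * laplace κ (z - w)) (y := z.im) (M := M * C)
    h₁₂ ?_ fun w hw => ?_
  · refine (hf.diff.mono fun w hw => h₁.trans_le hw.1).mul
      (h.differentiable_laplace.comp (by fun_prop)).differentiableOn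
  · rw [norm_mul, mul_assoc]
    have hw' := hf.bound w (h₁.trans_le hw.1)
    refine mul_le_mul hw' ?_ (norm_nonneg _) ((norm_nonneg _).trans hw')
    have := hw.1
    have := hw.2
    exact hb (z - w) (by rw [Complex.sub_re]; constructor <;> linarith)

lemma halfPlaneConv_eq (hf : IsBoundedHol f M) (h : IsKernel κ a b) {x : ℝ} (hx : 0 < x) (z : ℂ) :
    halfPlaneConv f κ z = conv (fun v => f (x + Complex.I * v)) κ (z - x) := by
  have := hf.conv_vertical_eq h (x₁ := 1) (x₂ := x) one_pos
  have := hf.conv_vertical_eq h (x₁ := x) (x₂ := 1) hx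
  rcases le_total 1 x with h1 | h1 <;> simp_all [halfPlaneConv]

lemma hasDerivAt_halfPlaneConv (hf : IsBoundedHol f M) (h : IsKernel κ a b) (z : ℂ) :
    HasDerivAt (halfPlaneConv f κ) (halfPlaneConv f (fun t : ℝ => -(t : ℂ) * κ t) z) z := by
  unfold halfPlaneConv
  have := (h.hasDerivAt_conv (φ := fun v => f (1 + Complex.I * v)) (M := M) ?_ ?_ (z - 1)).comp z
    ((hasDerivAt_id z).sub_const 1)
  · simpa only [Function.comp_def, id, mul_one] using this
  · exact (by simpa using hf.continuous_vertical one_pos : Continuous _).aestronglyMeasurable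
  · exact ae_of_all _ fun v => by simpa using hf.norm_vertical_le one_pos v

/-- The spectrum of a bounded holomorphic function on the right half-plane contains no negative
frequencies: the contour can be moved to `+∞`. -/
lemma halfPlaneConv_eq_zero (hf : IsBoundedHol f M) (h : IsKernel κ a b) (ha : a < 0) (hb : b < 0)
    (z : ℂ) : halfPlaneConv f κ z = 0 := by
  obtain ⟨C, -, hC⟩ := h.exists_norm_conv_le
  have hlim (c : ℝ) (hc : c < 0) :
      Tendsto (fun x : ℝ => Real.exp (-(c * (z.re - x)))) atTop (𝓝 0) := by
    refine Real.tendsto_exp_atBot.comp ?_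
    have : Tendsto (fun x : ℝ => -(c * z.re) + c * x) atTop atBot :=
      tendsto_atBot_add_const_left _ _ (tendsto_id.const_mul_atTop_of_neg hc)
    exact this.congr fun x => by ring
  have h0 : Tendsto (fun x : ℝ => C * M * expGrowth a b (z.re - x)) atTop (𝓝 0) := by
    simpa [expGrowth] using ((hlim a ha).add (hlim b hb)).const_mul (C * M)
  have h1 : Tendsto (fun _ : ℝ => halfPlaneConv f κ z) atTop (𝓝 0) := by
    refine squeeze_zero_norm' ?_ h0
    filter_upwards [eventually_gt_atTop 0] with x hx
    rw [hf.halfPlaneConv_eq h hx]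
    simpa using hC _ M (ae_of_all _ fun v => hf.norm_vertical_le hx v) (z - x)
  exact tendsto_nhds_unique tendsto_const_nhds h1

/-- The contour of the convolution can be moved to the boundary of the half-plane. -/
lemma halfPlaneConv_eq_conv (hf : IsBoundedHol f M) (h : IsKernel κ a b) {g : ℝ → ℂ}
    (hg : ∀ᵐ s : ℝ, Tendsto (fun α : ℝ => f (α + Complex.I * s)) (𝓝[>] 0) (𝓝 (g s))) (z : ℂ) :
    halfPlaneConv f κ z = conv g κ z := by
  obtain ⟨C, hC, hb⟩ := h.exists_norm_laplace_sub_le (z.re - 1) z.re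
  have h1 : Tendsto (fun x : ℝ => conv (fun v => f (x + Complex.I * v)) κ (z - x)) (𝓝[>] 0)
      (𝓝 (conv g κ z)) := by
    refine Tendsto.const_mul _ (tendsto_integral_filter_of_dominated_convergence
      (fun v => M * (C * (1 + (z.im - v) ^ 2)⁻¹)) ?_ ?_
      (((integrable_inv_one_add_sub_sq z.im).const_mul C).const_mul M) ?_)
    · filter_upwards [self_mem_nhdsWithin] with x hx
      exact ((hf.continuous_vertical hx).mul
        (h.continuous_laplace.comp (by fun_prop))).aestronglyMeasurable
    · filter_upwards [Ioc_mem_nhdsGT one_pos] with x hx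
      refine ae_of_all _ fun v => ?_
      rw [norm_mul]
      have hv := hf.norm_vertical_le hx.1 v
      refine mul_le_mul hv ?_ (norm_nonneg _) ((norm_nonneg _).trans hv)
      have h0 := hx.1
      have h1 := hx.2
      simpa using hb (z - x - Complex.I * v) (by simp; constructor <;> linarith)
    · filter_upwards [hg] with v hv
      refine hv.mul ?_
      have : Continuous fun x : ℝ => laplace κ (z - x - Complex.I * v) :=
        h.continuous_laplace.comp (by fun_prop)
      simpa using (this.tendsto 0).mono_left nhdsWithin_le_nhds
  refine tendsto_nhds_unique (tendsto_const_nhds.congr' ?_) h1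
  filter_upwards [self_mem_nhdsWithin] with x hx
  exact hf.halfPlaneConv_eq h hx z

/-- Rescaling the frequencies amounts to rescaling the imaginary translations. -/
lemma halfPlaneConv_comp_div (hf : IsBoundedHol f M) (h : IsKernel κ a b) {r : ℝ} (hr : 0 < r)
    {z : ℂ} (hz : z ∈ Cplus) :
    halfPlaneConv f (fun t => κ (t / r)) z =
      (2 * Real.pi : ℂ)⁻¹ * ∫ w : ℝ, f (z - Complex.I * (w / r : ℝ)) *
        laplace κ (Complex.I * w) := by
  rw [hf.halfPlaneConv_eq (h.comp_div hr) hz, conv]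
  congr 1
  have h1 := Measure.integral_comp_div (fun w : ℝ => f (z - Complex.I * w) *
        laplace κ (Complex.I * (r * w : ℝ))) r
  rw [← integral_sub_left_eq_self _ _ z.im]
  have h2 (w : ℝ) : r * (w / r) = w := by field_simp
  simp only [h2, abs_of_pos hr, Complex.real_smul] at h1
  rw [h1, ← integral_const_mul]
  congr 1; ext v
  rw [laplace_comp_div κ hr]
  have h3 : (z.re : ℂ) + Complex.I * (z.im - v : ℝ) = z - Complex.I * v := by
    conv_rhs => rw [← Complex.re_add_im z]
    push_cast; ring
  have h4 : z - z.re - Complex.I * (z.im - v : ℝ) = Complex.I * v := by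
    push_cast
    linear_combination -(Complex.re_add_im z)
  rw [h3, h4]
  push_cast
  ring_nf

/-! ### Cauchy estimates -/

lemma nonneg (hf : IsBoundedHol f M) : 0 ≤ M :=
  (norm_nonneg _).trans (hf.bound 1 (by simp [Cplus]))

lemma closedBall_half_subset {z : ℂ} (hz : z ∈ Cplus) :
    Metric.closedBall z (z.re / 2) ⊆ Cplus := by
  have : 0 < z.re := hz
  exact (Metric.closedBall_subset_ball (by linarith)).trans (ball_subset_Cplus z)

lemma norm_deriv_le (hf : IsBoundedHol f M) {z : ℂ} (hz : z ∈ Cplus) :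
    ‖deriv f z‖ ≤ M / (z.re / 2) := by
  have hz' : 0 < z.re := hz
  exact Complex.norm_deriv_le_of_forall_mem_sphere_norm_le (by linarith)
    (hf.diff.diffContOnCl_ball (closedBall_half_subset hz)) fun w hw =>
      hf.bound w (closedBall_half_subset hz (Metric.sphere_subset_closedBall hw))

lemma norm_deriv_le_of_mem_closedBall (hf : IsBoundedHol f M) {z w : ℂ} (hz : z ∈ Cplus)
    (hw : w ∈ Metric.closedBall z (z.re / 2)) : ‖deriv f w‖ ≤ M / (z.re / 4) := by
  have hz' : 0 < z.re := hz
  refine (hf.norm_deriv_le (closedBall_half_subset hz hw)).trans ?_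
  rw [mem_closedBall_iff_norm] at hw
  have := abs_le.1 ((Complex.abs_re_le_norm (w - z)).trans hw)
  simp only [Complex.sub_re] at this
  exact div_le_div_of_nonneg_left hf.nonneg (by linarith) (by linarith)

lemma norm_deriv_deriv_le (hf : IsBoundedHol f M) {z : ℂ} (hz : z ∈ Cplus) :
    ‖deriv (deriv f) z‖ ≤ M / (z.re / 4) / (z.re / 2) := by
  have hz' : 0 < z.re := hz
  exact Complex.norm_deriv_le_of_forall_mem_sphere_norm_le (by linarith)
    ((hf.diff.deriv isOpen_Cplus).diffContOnCl_ball (closedBall_half_subset hz)) fun w hw =>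
      hf.norm_deriv_le_of_mem_closedBall hz (Metric.sphere_subset_closedBall hw)

/-! ### Approximate identities -/

lemma sub_I_mul_mem {z : ℂ} (hz : z ∈ Cplus) (u : ℝ) : z - Complex.I * u ∈ Cplus := by
  simpa [Cplus] using hz

lemma continuous_sub_I_mul {g : ℂ → ℂ} (hg : ContinuousOn g Cplus) {z : ℂ} (hz : z ∈ Cplus)
    (r : ℝ) : Continuous fun w : ℝ => g (z - Complex.I * (w / r : ℝ)) :=
  hg.comp_continuous (by fun_prop) fun _ => sub_I_mul_mem hz _

lemma hasDerivAt_halfPlaneConv_comp_div (hf : IsBoundedHol f M) (h : IsKernel κ a b) {r : ℝ}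
    (hr : 0 < r) {z : ℂ} (hz : z ∈ Cplus) :
    HasDerivAt (halfPlaneConv f (fun t => κ (t / r)))
      ((2 * Real.pi : ℂ)⁻¹ * ∫ w : ℝ, deriv f (z - Complex.I * (w / r : ℝ)) *
        laplace κ (Complex.I * w)) z := by
  have hz' : 0 < z.re / 2 := half_pos hz
  have hL : Continuous fun w : ℝ => laplace κ (Complex.I * w) :=
    h.continuous_laplace.comp (by fun_prop)
  have hc := hf.diff.continuousOn
  have hc' := (hf.diff.deriv isOpen_Cplus).continuousOn
  have hD : HasDerivAt (fun z => (2 * Real.pi : ℂ)⁻¹ * ∫ w : ℝ,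
      f (z - Complex.I * (w / r : ℝ)) * laplace κ (Complex.I * w))
      ((2 * Real.pi : ℂ)⁻¹ * ∫ w : ℝ, deriv f (z - Complex.I * (w / r : ℝ)) *
        laplace κ (Complex.I * w)) z := by
    refine HasDerivAt.const_mul _ (hasDerivAt_integral_of_dominated_loc_of_deriv_le
      (Metric.ball_mem_nhds z hz')
      (bound := fun w : ℝ => M / (z.re / 4) * ‖laplace κ (Complex.I * w)‖)
      (F := fun z (w : ℝ) => f (z - Complex.I * (w / r : ℝ)) * laplace κ (Complex.I * w))
      ?_ ?_ (F' := fun z (w : ℝ) => deriv f (z - Complex.I * (w / r : ℝ)) * laplace κ (Complex.I * w))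
      ((continuous_sub_I_mul hc' hz r).mul hL).aestronglyMeasurable
      (ae_of_all _ fun w x hx => ?_) (h.integrable_laplace.norm.const_mul _)
      (ae_of_all _ fun w x hx => ?_)).2
    · filter_upwards [isOpen_Cplus.mem_nhds hz] with x hx
      exact ((continuous_sub_I_mul hc hx r).mul hL).aestronglyMeasurable
    · refine (h.integrable_laplace.norm.const_mul M).mono'
        ((continuous_sub_I_mul hc hz r).mul hL).aestronglyMeasurable (ae_of_all _ fun w => ?_)
      rw [norm_mul]
      gcongr
      exact hf.bound _ (sub_I_mul_mem hz _)
    · rw [norm_mul]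
      gcongr
      have hre : (z - Complex.I * (w / r : ℝ)).re = z.re := by
        rw [Complex.sub_re, Complex.re_mul_ofReal, Complex.I_re, zero_mul, sub_zero]
      rw [← hre]
      refine hf.norm_deriv_le_of_mem_closedBall (sub_I_mul_mem hz _) ?_
      rw [hre, mem_closedBall_iff_norm, sub_sub_sub_cancel_right]
      exact (mem_ball_iff_norm.1 hx).le
    · have hx' : x ∈ Cplus :=
        closedBall_half_subset hz (Metric.ball_subset_closedBall hx)
      have := ((hf.diff.differentiableAt (isOpen_Cplus.mem_nhds
        (sub_I_mul_mem hx' (w / r)))).hasDerivAt).comp x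
        ((hasDerivAt_id x).sub_const (Complex.I * (w / r : ℝ)))
      simpa only [Function.comp_def, id, mul_one] using this.mul_const (laplace κ (Complex.I * w))
  refine hD.congr_of_eventuallyEq ?_
  filter_upwards [isOpen_Cplus.mem_nhds hz] with x hx
  exact hf.halfPlaneConv_comp_div h hr hx

/-- Convolution with the Laplace transform of `κ(t / r)` approximates the identity as `r → ∞`. -/
lemma tendsto_halfPlaneConv_comp_div (hf : IsBoundedHol f M) (h : IsKernel κ a b) (h0 : κ 0 = 1)
    {z : ℂ} (hz : z ∈ Cplus) :
    Tendsto (fun r : ℝ => halfPlaneConv f (fun t => κ (t / r)) z) atTop (𝓝 (f z)) := by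
  have hL : Continuous fun w : ℝ => laplace κ (Complex.I * w) :=
    h.continuous_laplace.comp (by fun_prop)
  have h1 : Tendsto (fun r : ℝ => (2 * Real.pi : ℂ)⁻¹ * ∫ w : ℝ,
      f (z - Complex.I * (w / r : ℝ)) * laplace κ (Complex.I * w)) atTop
      (𝓝 ((2 * Real.pi : ℂ)⁻¹ * ∫ w : ℝ, f z * laplace κ (Complex.I * w))) := by
    refine Tendsto.const_mul _ (tendsto_integral_filter_of_dominated_convergence
      (fun w => M * ‖laplace κ (Complex.I * w)‖) (Eventually.of_forall fun r => ?_)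
      (Eventually.of_forall fun r => ae_of_all _ fun w => ?_)
      (h.integrable_laplace.norm.const_mul M) (ae_of_all _ fun w => ?_))
    · exact ((continuous_sub_I_mul hf.diff.continuousOn hz r).mul hL).aestronglyMeasurable
    · rw [norm_mul]
      gcongr
      exact hf.bound _ (sub_I_mul_mem hz _)
    · refine Tendsto.mul_const _ ?_
      have hw : Tendsto (fun r : ℝ => z - Complex.I * (w / r : ℝ)) atTop (𝓝 z) := by
        have : Tendsto (fun r : ℝ => w / r) atTop (𝓝 0) := tendsto_id.const_div_atTop w
        simpa using (((Complex.continuous_ofReal.tendsto 0).comp this).const_mul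
          Complex.I).const_sub z
      exact ((hf.diff.continuousOn.continuousAt (isOpen_Cplus.mem_nhds hz)).tendsto).comp hw
  rw [integral_const_mul, h.integral_laplace, h0] at h1
  have hp : (Real.pi : ℂ) ≠ 0 := by exact_mod_cast Real.pi_ne_zero
  have h2 : (2 * Real.pi : ℂ)⁻¹ * (f z * (2 * Real.pi * 1)) = f z := by field_simp
  rw [h2] at h1
  refine h1.congr' ?_
  filter_upwards [eventually_gt_atTop 0] with r hr
  exact (hf.halfPlaneConv_comp_div h hr hz).symm

/-- The rate of the approximation by high frequency cut-offs, for derivatives. -/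
lemma exists_norm_deriv_sub_le (hf : IsBoundedHol f M) (h : IsKernel κ a b) (h0 : κ 0 = 1) :
    ∃ C : ℝ, 0 ≤ C ∧ ∀ r : ℝ, 0 < r → ∀ z ∈ Cplus,
      ‖deriv f z - deriv (halfPlaneConv f (fun t => κ (t / r))) z‖ ≤ C / z.re ^ 2 / r := by
  refine ⟨8 * M * ((2 * Real.pi)⁻¹ * ∫ w : ℝ, ‖(w : ℂ) * laplace κ (Complex.I * w)‖),
    mul_nonneg (mul_nonneg (by norm_num) hf.nonneg)
      (mul_nonneg (by positivity) (integral_nonneg fun _ => norm_nonneg _)),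
    fun r hr z hz => ?_⟩
  have hz' : 0 < z.re := hz
  have hL : Continuous fun w : ℝ => laplace κ (Complex.I * w) :=
    h.continuous_laplace.comp (by fun_prop)
  have hp : (Real.pi : ℂ) ≠ 0 := by exact_mod_cast Real.pi_ne_zero
  have hd' := hf.diff.deriv isOpen_Cplus
  rw [(hf.hasDerivAt_halfPlaneConv_comp_div h hr hz).deriv]
  have h1 : deriv f z = (2 * Real.pi : ℂ)⁻¹ * ∫ w : ℝ, deriv f z * laplace κ (Complex.I * w) := by
    rw [integral_const_mul, h.integral_laplace, h0]
    field_simp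
  have h2 : Integrable fun w : ℝ => deriv f (z - Complex.I * (w / r : ℝ)) *
      laplace κ (Complex.I * w) := by
    refine (h.integrable_laplace.norm.const_mul (M / (z.re / 2))).mono'
        ((continuous_sub_I_mul hd'.continuousOn hz r).mul hL).aestronglyMeasurable
        (ae_of_all _ fun w => ?_)
    rw [norm_mul]
    gcongr
    have := hf.norm_deriv_le (sub_I_mul_mem hz (w / r))
    rwa [Complex.sub_re, Complex.re_mul_ofReal, Complex.I_re, zero_mul, sub_zero] at this
  have h3 (w : ℝ) : ‖deriv f z - deriv f (z - Complex.I * (w / r : ℝ))‖ ≤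
      M / (z.re / 4) / (z.re / 2) * (‖(w : ℂ)‖ / r) := by
    have := Convex.norm_image_sub_le_of_norm_deriv_le (f := deriv f) (s := {w | w.re = z.re})
      (C := M / (z.re / 4) / (z.re / 2)) (x := z - Complex.I * (w / r : ℝ)) (y := z)
      (fun x hx => hd'.differentiableAt (isOpen_Cplus.mem_nhds (hz'.trans_eq hx.symm)))
      (fun x hx => ?_) (convex_hyperplane Complex.reLm.isLinear z.re) ?_ rfl
    · refine this.trans_eq ?_
      rw [sub_sub_cancel, norm_mul, Complex.norm_I, one_mul, Complex.norm_real, Complex.norm_real,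
        norm_div, Real.norm_of_nonneg hr.le]
    · have h4 := hf.norm_deriv_deriv_le (z := x) (hz'.trans_eq hx.symm)
      rwa [show x.re = z.re from hx] at h4
    · show (z - Complex.I * (w / r : ℝ)).re = z.re
      rw [Complex.sub_re, Complex.re_mul_ofReal, Complex.I_re, zero_mul, sub_zero]
  nth_rewrite 1 [h1]
  rw [← mul_sub, ← integral_sub (h.integrable_laplace.const_mul _) h2]
  have h5 : ‖∫ w : ℝ, (deriv f z * laplace κ (Complex.I * w) -
      deriv f (z - Complex.I * (w / r : ℝ)) * laplace κ (Complex.I * w))‖ ≤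
      ∫ w : ℝ, M / (z.re / 4) / (z.re / 2) / r * ‖(w : ℂ) * laplace κ (Complex.I * w)‖ := by
    refine norm_integral_le_of_norm_le (h.integrable_mul_laplace.norm.const_mul _)
      (ae_of_all _ fun w => ?_)
    rw [← sub_mul, norm_mul, norm_mul, ← mul_assoc]
    gcongr
    exact (h3 w).trans_eq (by ring)
  rw [norm_mul]
  refine (mul_le_mul_of_nonneg_left h5 (norm_nonneg _)).trans_eq ?_
  rw [integral_const_mul, norm_inv, norm_mul, Complex.norm_ofNat, Complex.norm_real,
    Real.norm_of_nonneg Real.pi_pos.le]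
  generalize ∫ w : ℝ, ‖(w : ℂ) * laplace κ (Complex.I * w)‖ = J
  field_simp
  ring

/-- The cut-offs are uniformly bounded for the seminorm of `𝓑`, on each vertical line. -/
lemma exists_enorm_deriv_le (hf : IsBoundedHol f M) (h : IsKernel κ a b) :
    ∃ C : ℝ≥0∞, C < ⊤ ∧ ∀ r : ℝ, 0 < r → ∀ z ∈ Cplus,
      ‖deriv (halfPlaneConv f (fun t => κ (t / r))) z‖ₑ ≤
        C * ⨆ β : ℝ, ‖deriv f (z.re + Complex.I * β)‖ₑ := by
  refine ⟨‖(2 * Real.pi : ℂ)⁻¹‖ₑ * ∫⁻ w : ℝ, ‖laplace κ (Complex.I * w)‖ₑ,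
    ENNReal.mul_lt_top enorm_lt_top h.integrable_laplace.2, fun r hr z hz => ?_⟩
  rw [(hf.hasDerivAt_halfPlaneConv_comp_div h hr hz).deriv, enorm_mul, mul_assoc]
  gcongr
  refine (enorm_integral_le_lintegral_enorm _).trans ?_
  have hL : Continuous fun w : ℝ => laplace κ (Complex.I * w) :=
    h.continuous_laplace.comp (by fun_prop)
  rw [← lintegral_mul_const _ hL.enorm.measurable]
  refine lintegral_mono fun w => ?_
  rw [enorm_mul, mul_comm]
  gcongr
  refine le_of_eq_of_le ?_ (le_iSup _ (z.im - w / r))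
  congr 2
  push_cast
  linear_combination -(Complex.re_add_im z)

/-- Low frequency cut-offs have small derivatives. -/
lemma exists_norm_deriv_le (hf : IsBoundedHol f M) (h : IsKernel κ a b) :
    ∃ C : ℝ, 0 ≤ C ∧ ∀ r : ℝ, 0 < r → ∀ z ∈ Cplus,
      ‖deriv (halfPlaneConv f (fun t => κ (t / r))) z‖ ≤ C * r := by
  refine ⟨(2 * Real.pi)⁻¹ * ∫ w : ℝ,
    M * ‖laplace (fun t : ℝ => -(t : ℂ) * κ t) (Complex.I * w)‖,
    mul_nonneg (by positivity)
      (integral_nonneg fun _ => mul_nonneg hf.nonneg (norm_nonneg _)), fun r hr z hz => ?_⟩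
  rw [(hf.hasDerivAt_halfPlaneConv (h.comp_div hr) z).deriv]
  have h1 : halfPlaneConv f (fun t : ℝ => -(t : ℂ) * κ (t / r)) z =
      r * halfPlaneConv f (fun t => (fun t : ℝ => -(t : ℂ) * κ t) (t / r)) z := by
    have hr' : (r : ℂ) ≠ 0 := by exact_mod_cast hr.ne'
    have : laplace (fun t : ℝ => -(t : ℂ) * κ (t / r)) =
        fun z => r * laplace (fun t : ℝ => -((t / r : ℝ) : ℂ) * κ (t / r)) z := by
      ext z
      rw [laplace, laplace, ← integral_const_mul]
      congr 1; ext t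
      push_cast
      field_simp
    rw [halfPlaneConv, halfPlaneConv, conv, conv, this, mul_left_comm (r : ℂ),
      ← integral_const_mul (r : ℂ)]
    congr 1
    refine integral_congr_ae (ae_of_all _ fun v => ?_)
    ring
  rw [h1, hf.halfPlaneConv_comp_div h.neg_mul_self hr hz, norm_mul, norm_mul, Complex.norm_real,
    Real.norm_of_nonneg hr.le, mul_comm, norm_inv, norm_mul, Complex.norm_ofNat,
    Complex.norm_real, Real.norm_of_nonneg Real.pi_pos.le]
  gcongr
  refine norm_integral_le_of_norm_le (h.neg_mul_self.integrable_laplace.norm.const_mul M)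
    (ae_of_all _ fun w => ?_)
  rw [norm_mul]
  gcongr
  exact hf.bound _ (sub_I_mul_mem hz _)

end IsBoundedHol


/-! ### Supports of tempered distributions -/

/-- A tempered distribution vanishes on compactly supported test functions whose support does not
meet its own. -/
lemma apply_eq_zero_of_disjoint_dsupport (u : 𝓢'(ℝ, ℂ)) (φ : 𝓢(ℝ, ℂ))
    (hc : HasCompactSupport φ) (hd : Disjoint (tsupport φ) (Distribution.dsupport u)) :
    u φ = 0 := by
  have hU (x : tsupport φ) := (Distribution.notMem_dsupport_iff (f := u) x.1).1
    (disjoint_left.1 hd x.2)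
  choose U hvan hopen hmem using hU
  obtain ⟨ρ, hρ⟩ := SmoothPartitionOfUnity.exists_isSubordinate 𝓘(ℝ, ℝ) (isClosed_tsupport φ) U
    hopen fun x hx => mem_iUnion.2 ⟨⟨x, hx⟩, hmem _⟩
  have hfin := ρ.locallyFinite.finite_nonempty_inter_compact hc
  have hsm (i : tsupport φ) : ContDiff ℝ ∞ fun x => ((ρ i x : ℝ) : ℂ) * φ x :=
    (Complex.ofRealCLM.contDiff.comp (ρ i).contMDiff.contDiff).mul (φ.smooth ⊤)
  have hcs (i : tsupport φ) : HasCompactSupport fun x => ((ρ i x : ℝ) : ℂ) * φ x :=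
    hc.mul_left
  have hsum : φ = ∑ i ∈ hfin.toFinset, (hcs i).toSchwartzMap (hsm i) := by
    ext x
    rw [sum_apply]
    change φ x = ∑ i ∈ hfin.toFinset, ((ρ i x : ℝ) : ℂ) * φ x
    by_cases hx : x ∈ tsupport φ
    · have h1 := ρ.sum_eq_one hx
      rw [finsum_eq_sum_of_support_subset (s := hfin.toFinset)] at h1
      · rw [← Finset.sum_mul, ← Complex.ofReal_sum, h1]
        simp
      · intro i hi
        simp only [Finite.coe_toFinset, mem_ofPred_eq]
        exact ⟨x, hi, hx⟩
    · simp [image_eq_zero_of_notMem_tsupport hx]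
  rw [hsum, map_sum]
  refine Finset.sum_eq_zero fun i _ => hvan i _ ?_
  refine (closure_mono ?_).trans (hρ i)
  intro x hx
  contrapose! hx
  have : ρ i x = 0 := by simpa using hx
  change ¬(((ρ i x : ℝ) : ℂ) * φ x ≠ 0)
  simp [this]

lemma fourierInv_eq_laplace (φ : ℝ → ℂ) (s : ℝ) :
    𝓕⁻ φ s = laplace φ (-(2 * Real.pi * (Complex.I * s))) := by
  rw [Real.fourierInv_eq', laplace]
  congr 1; ext t
  rw [smul_eq_mul, mul_comm]
  congr 2
  simp; ring

lemma exists_ae_norm_le (g : Lp ℂ ∞ (volume : Measure ℝ)) : ∃ M : ℝ, ∀ᵐ v, ‖g v‖ ≤ M := by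
  refine ⟨(eLpNormEssSup g volume).toReal, ?_⟩
  filter_upwards [ae_le_eLpNormEssSup (f := g) (μ := volume)] with v hv
  rw [← toReal_enorm]
  refine ENNReal.toReal_mono ?_ hv
  have := (Lp.memLp g).2
  rw [eLpNorm_exponent_top] at this
  exact this.ne

/-- Convolution with the Laplace transform of `κ` only depends on `κ` near the spectrum. -/
lemma conv_eq_zero_of_disjoint {g : Lp ℂ ∞ (volume : Measure ℝ)} {κ : ℝ → ℂ} {a b : ℝ}
    (h : IsKernel κ a b) (hd : Disjoint (tsupport κ) (invFourierSupport g)) (z : ℂ) :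
    conv g κ z = 0 := by
  have hp : (0 : ℝ) < 2 * Real.pi := by positivity
  set ψ : ℝ → ℂ := fun t => 2 * Real.pi * (κ t * Complex.exp (-(z * t))) with hψ
  set φ : ℝ → ℂ := fun ξ => ψ (2 * Real.pi * ξ) with hφ
  have hsm : ContDiff ℝ ∞ φ := by
    refine ContDiff.comp (g := ψ) ?_ (contDiff_const.mul contDiff_id)
    refine contDiff_const.mul (h.smooth.mul ?_)
    exact (contDiff_const.mul Complex.ofRealCLM.contDiff).neg.cexp
  have hsupp : tsupport φ ⊆ (fun ξ => 2 * Real.pi * ξ) ⁻¹' tsupport κ := by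
    refine closure_minimal (fun ξ hξ => subset_closure ?_)
      ((isClosed_tsupport κ).preimage (by fun_prop))
    contrapose! hξ
    have : κ (2 * Real.pi * ξ) = 0 := by simpa using hξ
    simp [hφ, hψ, this]
  have hcs : HasCompactSupport φ := by
    refine (isCompact_Icc (a := a / (2 * Real.pi))
      (b := b / (2 * Real.pi))).of_isClosed_subset (isClosed_tsupport φ) fun ξ hξ => ?_
    have := h.supp (hsupp hξ)
    rw [mem_Icc, div_le_iff₀ hp, le_div_iff₀ hp, mul_comm ξ]
    exact this
  have hF (v : ℝ) : 𝓕⁻ φ v = laplace κ (z - Complex.I * v) := by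
    rw [Real.fourierInv_eq', laplace]
    have := Measure.integral_comp_mul_left
      (fun t : ℝ => κ t * Complex.exp (-((z - Complex.I * v) * t))) (2 * Real.pi)
    rw [abs_of_pos (inv_pos.2 hp), Complex.real_smul, Complex.ofReal_inv,
      eq_inv_mul_iff_mul_eq₀ (by exact_mod_cast hp.ne')] at this
    rw [← this, ← integral_const_mul]
    congr 1; ext ξ
    simp only [hφ, hψ, smul_eq_mul]
    have he : Complex.exp (-((z - Complex.I * v) * (2 * Real.pi * ξ : ℝ))) =
        Complex.exp ((2 * Real.pi * inner ℝ ξ v : ℝ) * Complex.I) *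
          Complex.exp (-(z * (2 * Real.pi * ξ : ℝ))) := by
      rw [← Complex.exp_add]
      congr 1
      simp; ring
    rw [he]
    push_cast
    ring
  have h0 := apply_eq_zero_of_disjoint_dsupport
    (𝓕⁻ (Lp.toTemperedDistribution g) : 𝓢'(ℝ, ℂ)) (hcs.toSchwartzMap hsm) hcs ?_
  · rw [TemperedDistribution.fourierInv_apply, Lp.toTemperedDistribution_apply] at h0
    rw [conv, mul_eq_zero]
    right
    rw [← h0]
    congr 1; ext v
    rw [SchwartzMap.fourierInv_coe, smul_eq_mul, mul_comm, ← hF]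
    rfl
  · rw [disjoint_left] at hd ⊢
    exact fun ξ hξ hξ' => hd (hsupp hξ) ⟨ξ, hξ', rfl⟩

/-! ### The Paley–Wiener description of `𝓖` -/

/-- A cut-off function for the interval with centre `c` and radius `ρ`. -/
lemma exists_isKernel_eq_one (c : ℝ) {ρ ε : ℝ} (hρ : 0 < ρ) (hε : 0 < ε) :
    ∃ χ : ℝ → ℂ, IsKernel χ (c - (ρ + ε)) (c + (ρ + ε)) ∧
      ∀ t ∈ Icc (c - ρ) (c + ρ), χ t = 1 := by
  let B : ContDiffBump c := ⟨ρ, ρ + ε, hρ, by linarith⟩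
  refine ⟨fun t => (B t : ℂ), .of_forall_notMem (Complex.ofRealCLM.contDiff.comp B.contDiff)
    fun t ht => ?_, fun t ht => ?_⟩
  · rw [← Real.closedBall_eq_Icc] at ht
    have : B t = 0 := B.zero_of_le_dist (le_of_lt (by simpa [Metric.mem_closedBall] using ht))
    simp [this]
  · rw [← Real.closedBall_eq_Icc] at ht
    simp [B.one_of_mem_closedBall ht]

/-- `f` is the restriction of an entire function that satisfies the Paley–Wiener bounds for some
interval `[a, b] ⊆ (0, ∞)` of frequencies. -/
def HasPaleyWienerExtension (f : Cplus → ℂ) : Prop :=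
  ∃ (F : ℂ → ℂ) (a b C : ℝ), 0 < a ∧ a ≤ b ∧ Differentiable ℂ F ∧
    (∀ z, ‖F z‖ ≤ C * expGrowth a b z.re) ∧ ∀ z : Cplus, F z = f z

lemma ext_apply (f : Cplus → ℂ) (z : Cplus) : ext f z = f z :=
  Subtype.val_injective.extend_apply f 0 z

lemma ext_eqOn {f : Cplus → ℂ} {F : ℂ → ℂ} (h : ∀ z : Cplus, F z = f z) :
    EqOn (ext f) F Cplus := fun z hz => by
  rw [h ⟨z, hz⟩, ← ext_apply f]

lemma isBoundedHol_ext {f : Cplus → ℂ} (hf : f ∈ Hol) {M : ℝ} (hM : ∀ z, ‖f z‖ ≤ M) :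
    IsBoundedHol (ext f) M :=
  ⟨hf, fun z hz => by simpa [ext_apply f ⟨z, hz⟩] using hM ⟨z, hz⟩⟩

lemma exists_subset_Icc {I : Set ℝ} (hI : IsCompact I) (hpos : I ⊆ Ioi 0) :
    ∃ a b, 0 < a ∧ a < b ∧ I ⊆ Icc a b := by
  rcases I.eq_empty_or_nonempty with rfl | hne
  · exact ⟨1, 2, by norm_num, by norm_num, empty_subset _⟩
  · obtain ⟨a, ha, ha'⟩ := hI.exists_isLeast hne
    obtain ⟨b, hb, hb'⟩ := hI.exists_isGreatest hne
    exact ⟨a, b + 1, hpos ha, by linarith [ha' hb], fun t ht => ⟨ha' ht, by linarith [hb' ht]⟩⟩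

lemma conv_sub {φ κ η : ℝ → ℂ} {a b c d : ℝ} (hκ : IsKernel κ a b) (hη : IsKernel η c d)
    (hφ : AEStronglyMeasurable φ) {M : ℝ} (hM : ∀ᵐ v, ‖φ v‖ ≤ M) (z : ℂ) :
    conv φ (fun t => κ t - η t) z = conv φ κ z - conv φ η z := by
  have hL : laplace (fun t => κ t - η t) = fun z => laplace κ z - laplace η z := by
    ext z
    rw [laplace, laplace, laplace, ← integral_sub (hκ.integrable_mul (by fun_prop))
      (hη.integrable_mul (by fun_prop))]
    simp_rw [sub_mul]
  rw [conv, conv, conv, hL, ← mul_sub, ← integral_sub (hκ.integrable_mul_laplace_sub hφ hM z)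
    (hη.integrable_mul_laplace_sub hφ hM z)]
  simp_rw [mul_sub]

/-- A convolution with the Laplace transform of a function supported in `[a, b] ⊆ (0, ∞)`
satisfies the Paley–Wiener bounds. -/
lemma hasPaleyWienerExtension_of_conv {φ κ : ℝ → ℂ} {a b M : ℝ} (h : IsKernel κ a b) (ha : 0 < a)
    (hab : a ≤ b) (hφ : AEStronglyMeasurable φ) (hM : ∀ᵐ v, ‖φ v‖ ≤ M) (w : ℂ) {f : Cplus → ℂ}
    (hf : ∀ z : Cplus, conv φ κ (z - w) = f z) : HasPaleyWienerExtension f := by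
  obtain ⟨C, hC, hb⟩ := h.exists_norm_conv_le
  have hM0 : 0 ≤ M := by
    obtain ⟨v, hv⟩ := hM.exists
    exact (norm_nonneg _).trans hv
  refine ⟨fun z => conv φ κ (z - w), a, b,
    C * M * (Real.exp (a * w.re) + Real.exp (b * w.re)), ha, hab, ?_, fun z => ?_, hf⟩
  · have : Differentiable ℂ (conv φ κ) := fun z => (h.hasDerivAt_conv hφ hM z).differentiableAt
    exact this.comp (differentiable_id.sub_const w)
  · refine (hb φ M hM _).trans ?_
    rw [mul_assoc _ (_ + _)]
    gcongr
    have e (c : ℝ) : Real.exp (-(c * (z - w).re)) =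
        Real.exp (c * w.re) * Real.exp (-(c * z.re)) := by
      rw [← Real.exp_add, Complex.sub_re]; ring_nf
    rw [expGrowth, e, e, expGrowth, add_mul, mul_add, mul_add]
    have := Real.exp_pos (a * w.re)
    have := Real.exp_pos (b * w.re)
    have := Real.exp_pos (-(a * z.re))
    have := Real.exp_pos (-(b * z.re))
    nlinarith [mul_pos (Real.exp_pos (a * w.re)) (Real.exp_pos (-(b * z.re))),
      mul_pos (Real.exp_pos (b * w.re)) (Real.exp_pos (-(a * z.re)))]

/-- Functions with spectrum in a compact subset of `(0, ∞)` reproduce themselves under convolution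
with the Laplace transform of a cut-off function. -/
lemma hasPaleyWienerExtension_of_mem_G {f : Cplus → ℂ} (hf : f ∈ G) :
    HasPaleyWienerExtension f := by
  obtain ⟨I, hI, hpos, ⟨hhol, M, hM⟩, g, hg, hsupp⟩ := hf
  obtain ⟨a, b, ha, hab, hIab⟩ := exists_subset_Icc hI hpos
  have hB := isBoundedHol_ext hhol hM
  obtain ⟨N, hN⟩ := exists_ae_norm_le g
  have hgm := Lp.aestronglyMeasurable g
  obtain ⟨χ, hχ, hχ1⟩ := exists_isKernel_eq_one ((a + b) / 2) (ρ := (b - a) / 2 + a / 4)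
    (ε := a / 4) (by linarith) (by linarith)
  obtain ⟨χ₀, hχ₀, hχ₀1⟩ := exists_isKernel_eq_one 0 one_pos one_pos
  refine hasPaleyWienerExtension_of_conv hχ (by linarith) (by linarith) hgm hN 0 fun z => ?_
  rw [sub_zero, ← ext_apply f]
  refine tendsto_nhds_unique (tendsto_const_nhds.congr' ?_)
    (hB.tendsto_halfPlaneConv_comp_div hχ₀ (hχ₀1 0 (by simp)) z.2)
  filter_upwards [eventually_ge_atTop (b + a / 2)] with r hr
  have hr0 : 0 < r := by linarith
  have hχr := hχ₀.comp_div hr0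
  rw [hB.halfPlaneConv_eq_conv hχr hg, eq_comm, ← sub_eq_zero,
    ← conv_sub hχr hχ hgm hN]
  refine conv_eq_zero_of_disjoint (hχr.sub hχ) ?_ _
  -- Both cut-offs equal one near the spectrum.
  have hz : tsupport (fun t => χ₀ (t / r) - χ t) ⊆ (Ioo (a - a / 4) (b + a / 4))ᶜ := by
    refine closure_minimal (fun t ht ht' => ht ?_) isOpen_Ioo.isClosed_compl
    rw [mem_Ioo] at ht'
    have h1 : χ t = 1 := hχ1 t ⟨by linarith, by linarith⟩
    have h2 : χ₀ (t / r) = 1 := hχ₀1 _ (by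
      rw [mem_Icc, le_div_iff₀ hr0, div_le_iff₀ hr0]
      constructor <;> linarith)
    simp [h1, h2]
  refine disjoint_left.2 fun t ht ht' => hz ht ?_
  have := hIab (hsupp ht')
  exact ⟨by linarith [this.1], by linarith [this.2]⟩


lemma tendsto_exp_neg_mul_atTop {c : ℝ} (hc : 0 < c) :
    Tendsto (fun x : ℝ => Real.exp (-(c * x))) atTop (𝓝 0) :=
  Real.tendsto_exp_neg_atTop_nhds_zero.comp (tendsto_id.const_mul_atTop hc)

lemma tendsto_exp_neg_mul_atBot {c : ℝ} (hc : c < 0) :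
    Tendsto (fun x : ℝ => Real.exp (-(c * x))) atBot (𝓝 0) :=
  Real.tendsto_exp_neg_atTop_nhds_zero.comp (tendsto_id.const_mul_atBot_of_neg hc)

lemma expGrowth_mul_expGrowth (a b c d x : ℝ) :
    expGrowth a b x * expGrowth c d x = Real.exp (-((a + c) * x)) + Real.exp (-((a + d) * x)) +
      Real.exp (-((b + c) * x)) + Real.exp (-((b + d) * x)) := by
  have e (p q : ℝ) : Real.exp (-((p + q) * x)) = Real.exp (-(p * x)) * Real.exp (-(q * x)) := by
    rw [← Real.exp_add]; ring_nf
  simp only [expGrowth, e]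
  ring

/-- On the Fourier side, a Paley–Wiener function with frequencies in `[a, b]` vanishes on test
functions supported to the left or to the right of `[a, b]`: in the pairing, the contour can be
moved to `+∞` or to `-∞`. -/
lemma integral_mul_laplace_eq_zero {F : ℂ → ℂ} {φ : ℝ → ℂ} {a b c d C : ℝ}
    (hF : Differentiable ℂ F) (hb : ∀ z, ‖F z‖ ≤ C * expGrowth a b z.re) (hab : a ≤ b)
    (hφ : IsKernel φ c d) (hcd : c ≤ d) (hdisj : 2 * Real.pi * d < a ∨ b < 2 * Real.pi * c) :
    ∫ v : ℝ, F (Complex.I * v) * laplace φ (-(2 * Real.pi * (Complex.I * v))) = 0 := by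
  have hp : (0 : ℝ) < 2 * Real.pi := by positivity
  have hp1 : (1 : ℝ) ≤ 2 * Real.pi := by linarith [Real.pi_gt_three]
  have hcd' : 2 * Real.pi * c ≤ 2 * Real.pi * d := by gcongr
  obtain ⟨D, hD, hD'⟩ := hφ.exists_norm_laplace_le
  set P : ℂ → ℂ := fun w => F w * laplace φ (-(2 * Real.pi * w)) with hP
  have hPd : Differentiable ℂ P := hF.mul (hφ.differentiable_laplace.comp (by fun_prop))
  set E : ℝ → ℝ := fun x =>
    expGrowth a b x * expGrowth (-(2 * Real.pi * c)) (-(2 * Real.pi * d)) x with hE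
  have hEc : Continuous E := (continuous_expGrowth _ _).mul (continuous_expGrowth _ _)
  have hC : 0 ≤ C := by
    have := (norm_nonneg _).trans (hb 0)
    exact nonneg_of_mul_nonneg_left this (by unfold expGrowth; positivity)
  have hPb (w : ℂ) : ‖P w‖ ≤ C * D * E w.re * (1 + (0 - w.im) ^ 2)⁻¹ := by
    have h1 := hD' (-(2 * Real.pi * w))
    have hre : (-(2 * Real.pi * w)).re = -(2 * Real.pi * w.re) := by simp
    have him : (-(2 * Real.pi * w)).im = -(2 * Real.pi * w.im) := by simp
    rw [hre, him] at h1
    have h2 : expGrowth c d (-(2 * Real.pi * w.re)) =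
        expGrowth (-(2 * Real.pi * c)) (-(2 * Real.pi * d)) w.re := by
      unfold expGrowth; ring_nf
    have h3 : (1 + (-(2 * Real.pi * w.im)) ^ 2)⁻¹ ≤ (1 + (0 - w.im) ^ 2)⁻¹ := by
      refine inv_anti₀ (by positivity) ?_
      nlinarith [mul_nonneg (mul_nonneg (sub_nonneg.2 hp1) (by linarith : 0 ≤ 2 * Real.pi + 1))
        (sq_nonneg w.im)]
    calc ‖P w‖ = ‖F w‖ * ‖laplace φ (-(2 * Real.pi * w))‖ := norm_mul _ _
      _ ≤ (C * expGrowth a b w.re) *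
          (D * expGrowth (-(2 * Real.pi * c)) (-(2 * Real.pi * d)) w.re *
            (1 + (0 - w.im) ^ 2)⁻¹) := by
        refine mul_le_mul (hb w) (h1.trans ?_) (norm_nonneg _)
          (mul_nonneg hC (expGrowth_nonneg _ _ _))
        rw [h2]
        exact mul_le_mul_of_nonneg_left h3 (mul_nonneg hD (expGrowth_nonneg _ _ _))
      _ = _ := by rw [hE]; ring
  have hshift (x₁ x₂ : ℝ) (hx : x₁ ≤ x₂) :
      ∫ v : ℝ, P (x₁ + Complex.I * v) = ∫ v : ℝ, P (x₂ + Complex.I * v) := by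
    obtain ⟨K, hK⟩ := isCompact_Icc.exists_bound_of_continuousOn hEc.continuousOn
      (s := Icc x₁ x₂)
    refine integral_vertical_eq (y := 0) (M := C * D * K) hx hPd.differentiableOn
      fun w hw => (hPb w).trans ?_
    gcongr
    exact (Real.le_norm_self _).trans (hK _ hw)
  have hshift0 (x : ℝ) :
      ∫ v : ℝ, P (Complex.I * v) = ∫ v : ℝ, P (x + Complex.I * v) := by
    rcases le_total 0 x with h | h
    · simpa using hshift 0 x h
    · simpa using (hshift x 0 h).symm
  have hnorm (x : ℝ) : ‖∫ v : ℝ, P (Complex.I * v)‖ ≤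
      C * D * E x * ∫ v : ℝ, (1 + (0 - v) ^ 2)⁻¹ := by
    rw [hshift0 x, ← integral_const_mul]
    refine norm_integral_le_of_norm_le ((integrable_inv_one_add_sub_sq 0).const_mul _)
      (ae_of_all _ fun v => ?_)
    simpa using hPb (x + Complex.I * v)
  have hlim : ∃ l : Filter ℝ, l.NeBot ∧ Tendsto E l (𝓝 0) := by
    simp only [hE, expGrowth_mul_expGrowth]
    rcases hdisj with h | h
    · refine ⟨atTop, inferInstance, ?_⟩
      simpa using (((tendsto_exp_neg_mul_atTop (c := a + -(2 * Real.pi * c)) (by linarith)).add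
        (tendsto_exp_neg_mul_atTop (c := a + -(2 * Real.pi * d)) (by linarith))).add
        (tendsto_exp_neg_mul_atTop (c := b + -(2 * Real.pi * c)) (by linarith))).add
        (tendsto_exp_neg_mul_atTop (c := b + -(2 * Real.pi * d)) (by linarith))
    · refine ⟨atBot, inferInstance, ?_⟩
      simpa using (((tendsto_exp_neg_mul_atBot (c := a + -(2 * Real.pi * c)) (by linarith)).add
        (tendsto_exp_neg_mul_atBot (c := a + -(2 * Real.pi * d)) (by linarith))).add
        (tendsto_exp_neg_mul_atBot (c := b + -(2 * Real.pi * c)) (by linarith))).add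
        (tendsto_exp_neg_mul_atBot (c := b + -(2 * Real.pi * d)) (by linarith))
  obtain ⟨l, _, hl⟩ := hlim
  have h0 := (hl.const_mul (C * D)).mul_const (∫ v : ℝ, (1 + (0 - v) ^ 2)⁻¹)
  rw [mul_zero, zero_mul] at h0
  exact tendsto_nhds_unique tendsto_const_nhds (squeeze_zero_norm hnorm h0)

lemma expGrowth_le_two {a b x : ℝ} (hab : a ≤ b) (hx : 0 ≤ x) :
    expGrowth a b x ≤ 2 * Real.exp (-(a * x)) := by
  have : Real.exp (-(b * x)) ≤ Real.exp (-(a * x)) := by gcongr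
  unfold expGrowth
  linarith

lemma mem_G_of_hasPaleyWienerExtension {f : Cplus → ℂ} (hf : HasPaleyWienerExtension f) :
    f ∈ G := by
  obtain ⟨F, a, b, C, ha, hab, hF, hb, hFf⟩ := hf
  have hC : 0 ≤ C := by
    have := (norm_nonneg _).trans (hb 0)
    exact nonneg_of_mul_nonneg_left this (by unfold expGrowth; positivity)
  have hcont : Continuous fun s : ℝ => F (Complex.I * s) := hF.continuous.comp (by fun_prop)
  have hmem : MemLp (fun s : ℝ => F (Complex.I * s)) ∞ volume :=
    memLp_top_of_bound hcont.aestronglyMeasurable (C * expGrowth a b 0)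
      (ae_of_all _ fun s => by simpa using hb (Complex.I * s))
  refine ⟨Icc a b, isCompact_Icc, fun t ht => ha.trans_le ht.1, ⟨?_, C * 2, fun z => ?_⟩,
    hmem.toLp, ?_, ?_⟩
  · exact hF.differentiableOn.congr (ext_eqOn hFf)
  · rw [← hFf]
    have hz : 0 < (z : ℂ).re := z.2
    refine (hb z).trans ?_
    gcongr
    refine (expGrowth_le_two hab hz.le).trans ?_
    have : Real.exp (-(a * (z : ℂ).re)) ≤ 1 := Real.exp_le_one_iff.2 (by nlinarith)
    linarith
  · filter_upwards [hmem.coeFn_toLp] with s hs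
    rw [hs]
    have h1 : Tendsto (fun α : ℝ => F (α + Complex.I * s)) (𝓝[>] 0) (𝓝 (F (Complex.I * s))) := by
      have : Continuous fun α : ℝ => F (α + Complex.I * s) := hF.continuous.comp (by fun_prop)
      simpa using (this.tendsto 0).mono_left nhdsWithin_le_nhds
    refine h1.congr' ?_
    filter_upwards [self_mem_nhdsWithin] with α hα
    exact (ext_eqOn hFf (by simpa [Cplus] using hα)).symm
  · rintro _ ⟨ξ, hξ, rfl⟩
    have hp : (0 : ℝ) < 2 * Real.pi := by positivity
    by_contra hnot
    -- A closed interval around `ξ` that does not meet the frequencies in `[a, b]`.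
    obtain ⟨δ, hδ, hdisj⟩ : ∃ δ > 0,
        2 * Real.pi * (ξ + δ) < a ∨ b < 2 * Real.pi * (ξ - δ) := by
      rw [mem_Icc, not_and_or, not_le, not_le] at hnot
      rcases hnot with h | h
      · refine ⟨(a - 2 * Real.pi * ξ) / (2 * (2 * Real.pi)), by
          apply div_pos <;> linarith, Or.inl ?_⟩
        field_simp
        linarith
      · refine ⟨(2 * Real.pi * ξ - b) / (2 * (2 * Real.pi)), by
          apply div_pos <;> linarith, Or.inr ?_⟩
        field_simp
        linarith
    refine (Distribution.notMem_dsupport_iff ξ).2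
      ⟨Ioo (ξ - δ) (ξ + δ), fun φ hφ => ?_, isOpen_Ioo, by constructor <;> linarith⟩ hξ
    have hk : IsKernel φ (ξ - δ) (ξ + δ) := ⟨φ.smooth ⊤, hφ.trans Ioo_subset_Icc_self⟩
    rw [TemperedDistribution.fourierInv_apply, Lp.toTemperedDistribution_apply,
      ← integral_mul_laplace_eq_zero hF hb hab hk (by linarith) hdisj]
    refine integral_congr_ae ?_
    filter_upwards [hmem.coeFn_toLp] with s hs
    rw [hs, SchwartzMap.fourierInv_coe, fourierInv_eq_laplace, smul_eq_mul, mul_comm]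

lemma mem_G_iff {f : Cplus → ℂ} : f ∈ G ↔ HasPaleyWienerExtension f :=
  ⟨hasPaleyWienerExtension_of_mem_G, mem_G_of_hasPaleyWienerExtension⟩

/-! ### Algebraic operations on `𝓖` and inclusion in `𝓑₀` -/

namespace HasPaleyWienerExtension

variable {f g : Cplus → ℂ}

lemma zero : HasPaleyWienerExtension 0 :=
  ⟨0, 1, 1, 0, one_pos, le_rfl, differentiable_const 0, by simp, by simp⟩

lemma const_smul (c : ℂ) (hf : HasPaleyWienerExtension f) : HasPaleyWienerExtension (c • f) := by
  obtain ⟨F, a, b, C, ha, hab, hF, hb, hFf⟩ := hf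
  refine ⟨c • F, a, b, ‖c‖ * C, ha, hab, hF.const_smul c, fun z => ?_, fun z => by simp [hFf]⟩
  rw [Pi.smul_apply, norm_smul, mul_assoc]
  gcongr
  exact hb z

lemma add (hf : HasPaleyWienerExtension f) (hg : HasPaleyWienerExtension g) :
    HasPaleyWienerExtension (f + g) := by
  obtain ⟨F, a, b, C, ha, hab, hF, hb, hFf⟩ := hf
  obtain ⟨H, a', b', C', ha', hab', hH, hb', hHg⟩ := hg
  have key {p q : ℝ} (hp : min a a' ≤ p) (hpq : p ≤ q) (hq : q ≤ max b b') (x : ℝ) :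
      expGrowth p q x ≤ 2 * expGrowth (min a a') (max b b') x := by
    rw [two_mul]
    exact add_le_add (exp_le_expGrowth ⟨hp, hpq.trans hq⟩ x) (exp_le_expGrowth ⟨hp.trans hpq, hq⟩ x)
  refine ⟨F + H, min a a', max b b', 2 * |C| + 2 * |C'|, lt_min ha ha',
    (min_le_left _ _).trans (hab.trans (le_max_left _ _)), hF.add hH, fun z => ?_,
    fun z => by simp [hFf, hHg]⟩
  refine (norm_add_le _ _).trans ?_
  rw [add_mul]
  gcongr
  · calc _ ≤ _ := hb z
      _ ≤ |C| * (2 * expGrowth (min a a') (max b b') z.re) :=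
        mul_le_mul (le_abs_self C) (key (min_le_left _ _) hab (le_max_left _ _) _)
          (expGrowth_nonneg _ _ _) (abs_nonneg _)
      _ = _ := by ring
  · calc _ ≤ _ := hb' z
      _ ≤ |C'| * (2 * expGrowth (min a a') (max b b') z.re) :=
        mul_le_mul (le_abs_self C') (key (min_le_right _ _) hab' (le_max_right _ _) _)
          (expGrowth_nonneg _ _ _) (abs_nonneg _)
      _ = _ := by ring

lemma mul (hf : HasPaleyWienerExtension f) (hg : HasPaleyWienerExtension g) :
    HasPaleyWienerExtension (f * g) := by
  obtain ⟨F, a, b, C, ha, hab, hF, hb, hFf⟩ := hf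
  obtain ⟨H, a', b', C', ha', hab', hH, hb', hHg⟩ := hg
  refine ⟨F * H, a + a', b + b', 4 * |C * C'|, by positivity, by linarith, hF.mul hH,
    fun z => ?_, fun z => by simp [hFf, hHg]⟩
  have h1 : expGrowth a b z.re * expGrowth a' b' z.re ≤
      4 * expGrowth (a + a') (b + b') z.re := by
    rw [expGrowth_mul_expGrowth]
    have k1 := exp_le_expGrowth (t := a + a') (a := a + a') (b := b + b')
      ⟨by linarith, by linarith⟩ z.re
    have k2 := exp_le_expGrowth (t := a + b') (a := a + a') (b := b + b')
      ⟨by linarith, by linarith⟩ z.re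
    have k3 := exp_le_expGrowth (t := b + a') (a := a + a') (b := b + b')
      ⟨by linarith, by linarith⟩ z.re
    have k4 := exp_le_expGrowth (t := b + b') (a := a + a') (b := b + b')
      ⟨by linarith, by linarith⟩ z.re
    linarith
  calc ‖(F * H) z‖ = ‖F z‖ * ‖H z‖ := norm_mul _ _
    _ ≤ (C * expGrowth a b z.re) * (C' * expGrowth a' b' z.re) :=
      mul_le_mul (hb z) (hb' z) (norm_nonneg _) ((norm_nonneg _).trans (hb z))
    _ = C * C' * (expGrowth a b z.re * expGrowth a' b' z.re) := by ring
    _ ≤ |C * C'| * (4 * expGrowth (a + a') (b + b') z.re) :=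
      mul_le_mul (le_abs_self _) h1
        (mul_nonneg (expGrowth_nonneg _ _ _) (expGrowth_nonneg _ _ _)) (abs_nonneg _)
    _ = _ := by ring

lemma isEntireOfExponentialType (hf : HasPaleyWienerExtension f) :
    IsEntireOfExponentialType f := by
  obtain ⟨F, a, b, C, ha, hab, hF, hb, hFf⟩ := hf
  refine ⟨F, hF, ⟨2 * |C|, b, fun z => ?_⟩, hFf⟩
  have h1 (c : ℝ) (hc : 0 < c) (hcb : c ≤ b) :
      Real.exp (-(c * z.re)) ≤ Real.exp (b * ‖z‖) := by
    gcongr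
    have h2 := abs_le.1 (Complex.abs_re_le_norm z)
    nlinarith [norm_nonneg z]
  have h2 : expGrowth a b z.re ≤ 2 * Real.exp (b * ‖z‖) := by
    rw [two_mul]
    exact add_le_add (h1 a ha hab) (h1 b (ha.trans_le hab) le_rfl)
  calc _ ≤ _ := hb z
    _ ≤ |C| * (2 * Real.exp (b * ‖z‖)) :=
      mul_le_mul (le_abs_self C) h2 (expGrowth_nonneg _ _ _) (abs_nonneg _)
    _ = _ := by ring

/-- The derivative decays exponentially as `Re z → ∞`, uniformly on vertical lines up to the
boundary, by Cauchy's estimate in discs of radius one. -/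
lemma mem_Besov₀ (hf : HasPaleyWienerExtension f) : f ∈ Besov₀ := by
  obtain ⟨F, a, b, C, ha, hab, hF, hb, hFf⟩ := hf
  have hE := ext_eqOn hFf
  have hC : 0 ≤ C := by
    have := (norm_nonneg _).trans (hb 0)
    exact nonneg_of_mul_nonneg_left this (by unfold expGrowth; positivity)
  refine ⟨⟨hF.differentiableOn.congr hE, ?_⟩, ?_⟩
  · set K : ℝ := C * (2 * Real.exp b) with hK
    have hd (z : ℂ) (hz : z ∈ Cplus) : ‖deriv (ext f) z‖ ≤ K * Real.exp (-(a * z.re)) := by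
      have hz' : 0 < z.re := hz
      rw [(hE.eventuallyEq_of_mem (isOpen_Cplus.mem_nhds hz)).deriv_eq]
      rw [← div_one (K * _)]
      refine Complex.norm_deriv_le_of_forall_mem_sphere_norm_le one_pos hF.diffContOnCl
        fun w hw => (hb w).trans ?_
      rw [mem_sphere_iff_norm] at hw
      have hre := abs_le.1 ((Complex.abs_re_le_norm (w - z)).trans hw.le)
      simp only [Complex.sub_re] at hre
      rw [hK, mul_assoc, mul_assoc]
      gcongr
      have h1 (c : ℝ) (hc : a ≤ c) (hcb : c ≤ b) :
          Real.exp (-(c * w.re)) ≤ Real.exp b * Real.exp (-(a * z.re)) := by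
        rw [← Real.exp_add]
        gcongr
        nlinarith [mul_nonneg (sub_nonneg.2 hc) hz'.le]
      rw [two_mul]
      exact add_le_add (h1 a le_rfl hab) (h1 b hab le_rfl)
    calc besovSeminorm f ≤ ∫⁻ α in Ioi (0 : ℝ), ENNReal.ofReal (K * Real.exp (-(a * α))) := by
          refine setLIntegral_mono (by fun_prop) fun α hα => iSup_le fun β => ?_
          rw [← ofReal_norm]
          refine ENNReal.ofReal_le_ofReal ?_
          simpa using hd (α + Complex.I * β) (by simpa [Cplus] using hα)
      _ < ⊤ := by
        have : Integrable (fun α : ℝ => K * Real.exp (-(a * α))) (volume.restrict (Ioi 0)) := by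
          have := exp_neg_integrableOn_Ioi 0 ha
          simp only [neg_mul] at this
          exact this.const_mul K
        exact this.lintegral_lt_top
  · have h1 : Tendsto (fun x : ℝ => C * expGrowth a b x) atTop (𝓝 0) := by
      simpa [expGrowth] using ((tendsto_exp_neg_mul_atTop ha).add
        (tendsto_exp_neg_mul_atTop (ha.trans_le hab))).const_mul C
    refine squeeze_zero_norm (fun z => ?_) (h1.comp tendsto_comap)
    rw [← hFf]
    exact hb z

end HasPaleyWienerExtension


/-! ### Density of `𝓖` in `𝓑₀` -/

/-- Functions that vanish at infinity are recovered by integrating their derivative. -/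
lemma supNorm_le_besovSeminorm {h : Cplus → ℂ} (hh : h ∈ Besov₀) :
    supNorm h ≤ besovSeminorm h := by
  obtain ⟨⟨hhol, -⟩, hlim⟩ := hh
  have hdiff : DifferentiableOn ℂ (ext h) Cplus := hhol
  refine iSup_le fun z => ?_
  have hz : 0 < (z : ℂ).re := z.2
  have hmem (t : ℝ) (ht : 0 < t) : (t : ℂ) + Complex.I * (z : ℂ).im ∈ Cplus := by
    simpa [Cplus] using ht
  have key (R : ℝ) (hR : (z : ℂ).re ≤ R) :
      ‖ext h (R + Complex.I * (z : ℂ).im) - ext h ((z : ℂ).re + Complex.I * (z : ℂ).im)‖ₑ ≤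
        besovSeminorm h := by
    have hd (t : ℝ) (ht : 0 < t) :
        HasDerivAt (fun t : ℝ => ext h (t + Complex.I * (z : ℂ).im))
          (deriv (ext h) (t + Complex.I * (z : ℂ).im)) t := by
      have h1 := (hdiff.differentiableAt (isOpen_Cplus.mem_nhds (hmem t ht))).hasDerivAt
      have h2 := h1.comp (t : ℂ) ((hasDerivAt_id (t : ℂ)).add_const (Complex.I * (z : ℂ).im))
      simpa only [Function.comp_def, id, mul_one] using h2.comp_ofReal
    have hpos (t : ℝ) (ht : t ∈ uIcc (z : ℂ).re R) : 0 < t := by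
      rw [uIcc_of_le hR] at ht
      exact hz.trans_le ht.1
    have hcont : ContinuousOn (fun t : ℝ => deriv (ext h) (t + Complex.I * (z : ℂ).im))
        (uIcc (z : ℂ).re R) :=
      (hdiff.deriv isOpen_Cplus).continuousOn.comp (by fun_prop) fun t ht => hmem t (hpos t ht)
    rw [← intervalIntegral.integral_eq_sub_of_hasDerivAt (fun t ht => hd t (hpos t ht))
      hcont.intervalIntegrable, intervalIntegral.integral_of_le hR]
    refine (enorm_integral_le_lintegral_enorm _).trans ?_
    refine (lintegral_mono_set fun t ht => hz.trans ht.1).trans ?_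
    exact lintegral_mono fun t => le_iSup
      (fun β : ℝ => ‖deriv (ext h) (t + Complex.I * β)‖ₑ) (z : ℂ).im
  set p : ℕ → Cplus := fun n => ⟨((z : ℂ).re + n : ℝ) + Complex.I * (z : ℂ).im,
    hmem _ (by positivity)⟩ with hp
  have hp_lim : Tendsto (fun n => h (p n)) atTop (𝓝 0) := by
    refine hlim.comp (tendsto_comap_iff.2 ?_)
    refine (tendsto_atTop_add_const_left _ (z : ℂ).re tendsto_natCast_atTop_atTop).congr
      fun n => ?_
    simp [hp]
  have hz' : ext h ((z : ℂ).re + Complex.I * (z : ℂ).im) = h z := by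
    rw [← ext_apply h z, mul_comm, Complex.re_add_im]
  have h1 : Tendsto (fun n => ‖h (p n) - h z‖ₑ) atTop (𝓝 ‖0 - h z‖ₑ) :=
    (hp_lim.sub_const _).enorm
  rw [zero_sub, enorm_neg] at h1
  refine le_of_tendsto h1 (Eventually.of_forall fun n => ?_)
  rw [← ext_apply h (p n), ← hz']
  exact key _ (by simp)

lemma aemeasurable_iSup_deriv {f : ℂ → ℂ} (hf : DifferentiableOn ℂ f Cplus) :
    AEMeasurable (fun α : ℝ => ⨆ β : ℝ, ‖deriv f (α + Complex.I * β)‖ₑ)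
      (volume.restrict (Ioi 0)) := by
  refine ⟨fun α : ℝ => ⨆ q : ℚ, ‖deriv f (α + Complex.I * (q : ℝ))‖ₑ,
    Measurable.iSup fun q => ((measurable_deriv f).comp (by fun_prop)).enorm, ?_⟩
  filter_upwards [ae_restrict_mem measurableSet_Ioi] with α hα
  have hc : Continuous fun β : ℝ => ‖deriv f (α + Complex.I * β)‖ₑ :=
    ((hf.deriv isOpen_Cplus).continuousOn.comp_continuous (by fun_prop)
      fun β => by simpa [Cplus] using hα).enorm
  refine le_antisymm (iSup_le fun β => ?_)
    (iSup_le fun q => le_iSup (fun β : ℝ => ‖deriv f (α + Complex.I * β)‖ₑ) q)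
  exact Rat.denseRange_cast.induction_on β (isClosed_le hc continuous_const)
    fun q => le_iSup (fun q : ℚ => ‖deriv f (α + Complex.I * (q : ℝ))‖ₑ) q

namespace IsBoundedHol

variable {f : ℂ → ℂ} {M : ℝ} {κ η χ : ℝ → ℂ} {a b c d : ℝ}

lemma halfPlaneConv_sub (hf : IsBoundedHol f M) (hκ : IsKernel κ a b) (hη : IsKernel η c d)
    (z : ℂ) :
    halfPlaneConv f (fun t => κ t - η t) z = halfPlaneConv f κ z - halfPlaneConv f η z := by
  refine conv_sub hκ hη (M := M) ?_ (ae_of_all _ fun v => ?_) _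
  · exact (by simpa using hf.continuous_vertical one_pos : Continuous _).aestronglyMeasurable
  · simpa using hf.norm_vertical_le one_pos v

/-- Cutting off the frequencies above `2N` and below `1 / N` gives a Paley–Wiener function, because
the negative frequencies do not contribute. -/
lemma hasPaleyWienerExtension_cutoff (hf : IsBoundedHol f M) (hχ : IsKernel χ (-2) 2)
    (hχ1 : ∀ t ∈ Icc (-1) 1, χ t = 1) {N : ℝ} (hN : 1 ≤ N) :
    HasPaleyWienerExtension fun z => halfPlaneConv f (fun t => χ (t / N)) z -
      halfPlaneConv f (fun t => χ (t / N⁻¹)) z := by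
  have hN0 : 0 < N := by linarith
  have hinv : N⁻¹ ≤ 1 := inv_le_one_of_one_le₀ hN
  have hinv0 : 0 < N⁻¹ := inv_pos.2 hN0
  have hmul : N * N⁻¹ = 1 := mul_inv_cancel₀ hN0.ne'
  have h1 := hχ.comp_div hN0
  have h2 := hχ.comp_div hinv0
  -- `κ` vanishes near the origin, so a smooth step `σ` splits it into its parts on the two half-lines.
  set κ : ℝ → ℂ := fun t => χ (t / N) - χ (t / N⁻¹) with hκ
  have hk : IsKernel κ _ _ := h1.sub h2
  set σ : ℝ → ℂ := fun t => (Real.smoothTransition (N * t) : ℂ) with hσ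
  have hσs : ContDiff ℝ ∞ σ := Complex.ofRealCLM.contDiff.comp
    (Real.smoothTransition.contDiff.comp (contDiff_const.mul contDiff_id))
  have hσ0 (t : ℝ) (ht : t ≤ 0) : σ t = 0 := by
    simp [hσ, Real.smoothTransition.zero_of_nonpos (mul_nonpos_of_nonneg_of_nonpos hN0.le ht)]
  have hσ1 (t : ℝ) (ht : N⁻¹ ≤ t) : σ t = 1 := by
    have : 1 ≤ N * t := by rw [← hmul]; gcongr
    simp [hσ, Real.smoothTransition.one_of_one_le this]
  have hlow (t : ℝ) (ht : -N⁻¹ ≤ t) (ht' : t ≤ N⁻¹) : κ t = 0 := by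
    have e1 : χ (t / N) = 1 := hχ1 _ (by
      rw [mem_Icc, le_div_iff₀ hN0, div_le_iff₀ hN0]; constructor <;> linarith)
    have e2 : χ (t / N⁻¹) = 1 := hχ1 _ (by
      rw [mem_Icc, le_div_iff₀ hinv0, div_le_iff₀ hinv0]; constructor <;> linarith)
    simp only [hκ, e1, e2, sub_self]
  have hhigh (t : ℝ) (ht : t < -(2 * N) ∨ 2 * N < t) : κ t = 0 := by
    have e1 : χ (t / N) = 0 := h1.eq_zero fun h => by
      rcases ht with ht | ht <;> linarith [h.1, h.2]
    have e2 : χ (t / N⁻¹) = 0 := h2.eq_zero fun h => by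
      rcases ht with ht | ht <;> linarith [h.1, h.2]
    simp only [hκ, e1, e2, sub_self]
  have hplus : IsKernel (fun t => σ t * κ t) N⁻¹ (2 * N) := by
    refine .of_forall_notMem (hk.mul_left hσs).smooth fun t ht => ?_
    rw [mem_Icc, not_and_or, not_le, not_le] at ht
    rcases ht with ht | ht
    · rcases le_total t 0 with h0 | h0
      · simp [hσ0 t h0]
      · simp [hlow t (by linarith) ht.le]
    · simp [hhigh t (Or.inr ht)]
  have hminus : IsKernel (fun t => κ t - σ t * κ t) (-(2 * N)) (-N⁻¹) := by
    refine .of_forall_notMem (hk.sub hplus).smooth fun t ht => ?_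
    rw [mem_Icc, not_and_or, not_le, not_le] at ht
    rcases ht with ht | ht
    · simp [hhigh t (Or.inl ht)]
    · rcases le_total t N⁻¹ with h0 | h0
      · simp [hlow t ht.le h0]
      · simp [hσ1 t h0]
  refine hasPaleyWienerExtension_of_conv (φ := fun v => f (1 + Complex.I * v)) (M := M) hplus
    hinv0 (by linarith) ?_ (ae_of_all _ fun v => ?_) 1 fun z => ?_
  · exact (by simpa using hf.continuous_vertical one_pos : Continuous _).aestronglyMeasurable
  · simpa using hf.norm_vertical_le one_pos v
  · have e1 := hf.halfPlaneConv_eq_zero hminus (by linarith) (by linarith) z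
    rw [hf.halfPlaneConv_sub hk hplus, sub_eq_zero] at e1
    rw [← hf.halfPlaneConv_sub h1 h2]
    exact e1.symm

end IsBoundedHol

lemma exists_mem_G_besovNorm_sub_lt {f : Cplus → ℂ} (hf : f ∈ Besov₀) {ε : ℝ≥0∞} (hε : 0 < ε) :
    ∃ g ∈ G, besovNorm (f - g) < ε := by
  obtain ⟨⟨hhol, hfin⟩, hlim⟩ := id hf
  have hsup := (supNorm_le_besovSeminorm hf).trans_lt hfin
  have hB : IsBoundedHol (ext f) (supNorm f).toReal := isBoundedHol_ext hhol fun z => by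
    rw [← toReal_enorm]
    exact ENNReal.toReal_mono hsup.ne (le_iSup (fun z => ‖f z‖ₑ) z)
  obtain ⟨χ, hχ', hχ1'⟩ := exists_isKernel_eq_one 0 one_pos one_pos
  have hχ : IsKernel χ (-2) 2 := by convert hχ' using 1 <;> norm_num
  have hχ1 : ∀ t ∈ Icc (-1) 1, χ t = 1 := fun t ht => hχ1' t (by simpa using ht)
  obtain ⟨A, -, hA'⟩ := hB.exists_norm_deriv_sub_le hχ (hχ1 0 (by simp))
  obtain ⟨D, -, hD'⟩ := hB.exists_norm_deriv_le hχ
  obtain ⟨K, hK, hK'⟩ := hB.exists_enorm_deriv_le hχ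
  set N : ℕ → ℝ := fun n => n + 1 with hN
  have hN1 (n : ℕ) : 1 ≤ N n := by simp [hN]
  have hN0 (n : ℕ) : 0 < N n := one_pos.trans_le (hN1 n)
  set S : ℝ → ℂ → ℂ := fun r => halfPlaneConv (ext f) (fun t => χ (t / r)) with hS
  have hSd (r : ℝ) (hr : 0 < r) (z : ℂ) : DifferentiableAt ℂ (S r) z :=
    (hB.hasDerivAt_halfPlaneConv (hχ.comp_div hr) z).differentiableAt
  set g : ℕ → Cplus → ℂ := fun n z => S (N n) z - S (N n)⁻¹ z with hg
  have hgPW (n : ℕ) : HasPaleyWienerExtension (g n) :=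
    hB.hasPaleyWienerExtension_cutoff hχ hχ1 (hN1 n)
  have hfg (n : ℕ) : EqOn (ext (f - g n))
      (fun z => ext f z - (S (N n) z - S (N n)⁻¹ z)) Cplus :=
    ext_eqOn fun z => by rw [ext_apply f z]; rfl
  have hderiv (n : ℕ) (z : ℂ) (hz : z ∈ Cplus) : deriv (ext (f - g n)) z =
      deriv (ext f) z - deriv (S (N n)) z + deriv (S (N n)⁻¹) z := by
    have d1 := (hB.diff.differentiableAt (isOpen_Cplus.mem_nhds hz)).hasDerivAt
    have d2 := (hSd _ (hN0 n) z).hasDerivAt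
    have d3 := (hSd _ (inv_pos.2 (hN0 n)) z).hasDerivAt
    rw [((hfg n).eventuallyEq_of_mem (isOpen_Cplus.mem_nhds hz)).deriv_eq,
      (show deriv (fun z => ext f z - (S (N n) z - S (N n)⁻¹ z)) z = _ from
        (d1.sub (d2.sub d3)).deriv)]
    ring
  set m : ℝ → ℝ≥0∞ := fun α => ⨆ β : ℝ, ‖deriv (ext f) (α + Complex.I * β)‖ₑ with hm
  set B : ℕ → ℝ → ℝ≥0∞ := fun n α =>
    min ((1 + K + K) * m α) (ENNReal.ofReal ((A / α ^ 2 + D) * (N n)⁻¹)) with hBdef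
  have hle (n : ℕ) : besovSeminorm (f - g n) ≤ ∫⁻ α in Ioi (0 : ℝ), B n α := by
    refine setLIntegral_mono' measurableSet_Ioi fun α hα => iSup_le fun β => ?_
    have hz : (α : ℂ) + Complex.I * β ∈ Cplus := by simpa [Cplus] using hα
    have hre : ((α : ℂ) + Complex.I * β).re = α := by simp
    rw [hderiv n _ hz]
    refine le_min ?_ ?_
    · have h1 : ‖deriv (ext f) (α + Complex.I * β)‖ₑ ≤ m α :=
        le_iSup (fun β : ℝ => ‖deriv (ext f) (α + Complex.I * β)‖ₑ) β
      have h2 := hK' _ (hN0 n) _ hz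
      have h3 := hK' _ (inv_pos.2 (hN0 n)) _ hz
      rw [hre] at h2 h3
      calc _ ≤ _ := (enorm_add_le _ _).trans (add_le_add_left (enorm_sub_le) _)
        _ ≤ m α + K * m α + K * m α := add_le_add (add_le_add h1 h2) h3
        _ = _ := by ring
    · rw [← ofReal_norm]
      refine ENNReal.ofReal_le_ofReal ((norm_add_le _ _).trans ?_)
      have h2 := hA' _ (hN0 n) _ hz
      have h3 := hD' _ (inv_pos.2 (hN0 n)) _ hz
      rw [hre] at h2
      refine (add_le_add h2 h3).trans_eq ?_
      rw [div_eq_mul_inv _ (N n)]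
      ring
  have hmm : AEMeasurable m (volume.restrict (Ioi 0)) := aemeasurable_iSup_deriv hB.diff
  have hKt : 1 + K + K ≠ ⊤ := by simp [hK.ne]
  have hBlim : Tendsto (fun n => ∫⁻ α in Ioi (0 : ℝ), B n α) atTop (𝓝 0) := by
    have := tendsto_lintegral_of_dominated_convergence' (μ := volume.restrict (Ioi (0 : ℝ)))
      (F := B) (f := fun _ => 0) (fun α => (1 + K + K) * m α)
      (fun n => (hmm.const_mul _).min (by fun_prop))
      (fun n => ae_of_all _ fun α => min_le_left _ _) ?_ (ae_of_all _ fun α => ?_)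
    · simpa using this
    · rw [lintegral_const_mul' _ _ hKt]
      exact ENNReal.mul_ne_top hKt hfin.ne
    · have h1 : Tendsto (fun n : ℕ => ENNReal.ofReal ((A / α ^ 2 + D) * (N n)⁻¹)) atTop (𝓝 0) := by
        have : Tendsto (fun n => (N n)⁻¹) atTop (𝓝 0) :=
          (tendsto_atTop_add_const_right _ 1 tendsto_natCast_atTop_atTop).inv_tendsto_atTop
        simpa using ENNReal.tendsto_ofReal (this.const_mul (A / α ^ 2 + D))
      exact tendsto_of_tendsto_of_tendsto_of_le_of_le tendsto_const_nhds h1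
        (fun _ => zero_le) fun n => min_le_right _ _
  have hsmall : 0 < min (ε / 2) 1 := lt_min (ENNReal.half_pos hε.ne') one_pos
  obtain ⟨n, hn⟩ := (hBlim.eventually (gt_mem_nhds hsmall)).exists
  have hn' := (hle n).trans_lt hn
  refine ⟨g n, mem_G_iff.2 (hgPW n), ?_⟩
  have hmem : f - g n ∈ Besov₀ := by
    refine ⟨⟨?_, hn'.trans (lt_of_le_of_lt (min_le_right _ _) ENNReal.one_lt_top)⟩, ?_⟩
    · exact (hB.diff.sub fun z _ => ((hSd _ (hN0 n) z).sub
        (hSd _ (inv_pos.2 (hN0 n)) z)).differentiableWithinAt).congr (hfg n)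
    · have := hlim.sub (hgPW n).mem_Besov₀.2
      rwa [sub_zero] at this
  have hlt := hn'.trans_le (min_le_left _ _)
  calc besovNorm (f - g n) ≤ besovSeminorm (f - g n) + besovSeminorm (f - g n) :=
        add_le_add_left (supNorm_le_besovSeminorm hmem) _
    _ < ε / 2 + ε / 2 := ENNReal.add_lt_add hlt hlt
    _ = ε := ENNReal.add_halves ε

lemma besovClosure_subset {S : Set (Cplus → ℂ)} (hS : S ⊆ Besov₀) : besovClosure S ⊆ Besov₀ := by
  rintro f ⟨hf, happ⟩
  refine ⟨hf, Metric.tendsto_nhds.2 fun ε hε => ?_⟩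
  obtain ⟨g, hg, hfg⟩ := happ (ENNReal.ofReal (ε / 2)) (by simpa using hε)
  filter_upwards [Metric.tendsto_nhds.1 (hS hg).2 (ε / 2) (half_pos hε)] with z hz
  have h1 : ‖f z - g z‖ₑ < ENNReal.ofReal (ε / 2) :=
    ((le_iSup (fun z => ‖(f - g) z‖ₑ) z).trans le_self_add).trans_lt hfg
  rw [← ofReal_norm, ENNReal.ofReal_lt_ofReal_iff (half_pos hε)] at h1
  rw [dist_zero_right] at hz ⊢
  calc ‖f z‖ = ‖(f z - g z) + g z‖ := by rw [sub_add_cancel]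
    _ ≤ ‖f z - g z‖ + ‖g z‖ := norm_add_le _ _
    _ < ε := by linarith

end AnalyticBesov

theorem theorem3p5 :
    (∃ A : NonUnitalSubalgebra ℂ (AnalyticBesov.Cplus → ℂ),
      (A : Set (AnalyticBesov.Cplus → ℂ)) = AnalyticBesov.G) ∧
    AnalyticBesov.G ⊆ AnalyticBesov.Besov₀ ∧
    (∀ f ∈ AnalyticBesov.G, AnalyticBesov.IsEntireOfExponentialType f) ∧
    AnalyticBesov.besovClosure AnalyticBesov.G = AnalyticBesov.Besov₀ := by
  have hsub : AnalyticBesov.G ⊆ AnalyticBesov.Besov₀ :=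
    fun f hf => (AnalyticBesov.mem_G_iff.1 hf).mem_Besov₀
  refine ⟨⟨{
    carrier := AnalyticBesov.G
    zero_mem' := AnalyticBesov.mem_G_iff.2 .zero
    add_mem' := fun hf hg => AnalyticBesov.mem_G_iff.2
      ((AnalyticBesov.mem_G_iff.1 hf).add (AnalyticBesov.mem_G_iff.1 hg))
    mul_mem' := fun hf hg => AnalyticBesov.mem_G_iff.2
      ((AnalyticBesov.mem_G_iff.1 hf).mul (AnalyticBesov.mem_G_iff.1 hg))
    smul_mem' := fun c _ hf => AnalyticBesov.mem_G_iff.2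
      ((AnalyticBesov.mem_G_iff.1 hf).const_smul c) }, rfl⟩, hsub,
    fun f hf => (AnalyticBesov.mem_G_iff.1 hf).isEntireOfExponentialType,
    (AnalyticBesov.besovClosure_subset hsub).antisymm fun f hf =>
      ⟨hf.1, fun ε hε => AnalyticBesov.exists_mem_G_besovNorm_sub_lt hf hε⟩⟩
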